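/- The diamond graph $D_0$ consists of two vertices joined by an edge of length $1$; $D_{n}$ is obtained from $D_{n-1}$ by replacing each edge $uv$ of $D_{n-1}$ by a quadrilateral $u,a,v,b$ (with new vertices $a,b$ for each edge, and new edges $ua,av,vb,bu$) whose edges have length $2^{-n}$. Each vertex set $V(D_n)$ carries its shortest path metric, and the inclusions $V(D_n)\subset V(D_{n+1})$ are isometric; the infinite diamond $D_\omega$ is the union $\bigcup_{n\ge 0}V(D_n)$ with the resulting metric. A metric space $A$ is bilipschitz embeddable into a metric space $B$ if there are a map $F:A\to B$ and constants $r>0$ and $C<\infty$ with $r\,d_A(u,v)\le d_B(F(u),F(v))\le rC\,d_A(u,v)$ for all $u,v\in A$. A Banach space $X$ has the Radon–Nikodým property (RNP) if for every finite measure space $(\Omega,\Sigma,\mu)$ and every countably additive measure $\nu:\Sigma\to X$ of bounded variation with $\nu\ll\mu$ there is a Bochner integrable $g:\Omega\to X$ with $\nu(A)=\int_A g\,d\mu$ for all $A\in\Sigma$. For $\delta>0$, a $\delta$-tree in $X$ is a sequence $(x_i)_{i\ge 1}$ in $X$ with $x_i=\frac12(x_{2i}+x_{2i+1})$ and $\|x_{2i}-x_i\|=\|x_{2i+1}-x_i\|\ge\delta$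 for all $i\ge 1$. **Corollary.** If $D_\omega$ is bilipschitz embeddable into a Banach space $X$, then $X$ does not have the Radon–Nikodým property. The converse is not true: there is a Banach space $X$ which does not have the Radon–Nikodým property, which contains no bounded $\delta$-tree for any $\delta>0$, and into which $D_\omega$ is not bilipschitz embeddable. -/

import Mathlib

open MeasureTheory

/-! ### Diamond graphs -/

/-- One step of the diamond construction: every edge `uv` of `G` is replaced by a quadrilateral
`u, a, v, b`. The two new vertices belonging to the edge `e` are `(e, true)` and `(e, false)`;
each of them is joined to both endpoints of `e`, and there are no other edges. -/
def diamondStep {V : Type} (G : SimpleGraph V) : SimpleGraph (V ⊕ (G.edgeSet × Bool)) where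
  Adj x y :=
    match x, y with
    | Sum.inl u, Sum.inr p => u ∈ (p.1 : Sym2 V)
    | Sum.inr p, Sum.inl u => u ∈ (p.1 : Sym2 V)
    | _, _ => False
  symm := ⟨by rintro (u | p) (v | q) h <;> exact h⟩
  loopless := ⟨by rintro (u | p) h <;> exact h⟩

/-- The diamond graphs together with their vertex sets: level `0` is a single edge, and level
`n + 1` is obtained from level `n` by replacing each edge by a quadrilateral. -/
def diamondData : ℕ → Σ V : Type, SimpleGraph V
  | 0 => ⟨Bool, ⊤⟩
  | n + 1 => ⟨_, diamondStep (diamondData n).2⟩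

/-- The vertex set of the diamond graph of level `n`. -/
def DiamondVertex (n : ℕ) : Type := (diamondData n).1

/-- The diamond graph of level `n`. -/
def diamondGraph (n : ℕ) : SimpleGraph (DiamondVertex n) := (diamondData n).2

/-- The inclusion of the vertex set of level `n` in the vertex set of level `n + 1`. -/
def diamondIncl (n : ℕ) (u : DiamondVertex n) : DiamondVertex (n + 1) :=
  (Sum.inl u : (diamondData n).1 ⊕ ((diamondData n).2.edgeSet × Bool))

theorem diamondStep_adj_edge {V : Type} (G : SimpleGraph V) {u v : V} (h : G.Adj u v) :
    ∃ p, (diamondStep G).Adj (Sum.inl u) p ∧ (diamondStep G).Adj p (Sum.inl v) :=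
  ⟨Sum.inr (⟨s(u, v), h⟩, true), Sym2.mem_mk_left u v, Sym2.mem_mk_right u v⟩

theorem diamondStep_exists_walk {V : Type} (G : SimpleGraph V) {u v : V} (w : G.Walk u v) :
    ∃ w' : (diamondStep G).Walk (Sum.inl u) (Sum.inl v), w'.length = 2 * w.length := by
  induction w with
  | nil => exact ⟨SimpleGraph.Walk.nil, rfl⟩
  | cons h w ih =>
    obtain ⟨w', hw'⟩ := ih
    obtain ⟨p, h1, h2⟩ := diamondStep_adj_edge G h
    refine ⟨SimpleGraph.Walk.cons h1 (SimpleGraph.Walk.cons h2 w'), ?_⟩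
    simp only [SimpleGraph.Walk.length_cons, hw']
    ring

theorem diamondStep_connected {V : Type} {G : SimpleGraph V} (hG : G.Connected) :
    (diamondStep G).Connected := by
  have hne : Nonempty V := hG.nonempty
  have key : ∀ u v : V, (diamondStep G).Reachable (Sum.inl u) (Sum.inl v) := fun u v => by
    obtain ⟨w⟩ := hG.preconnected u v
    obtain ⟨w', -⟩ := diamondStep_exists_walk G w
    exact ⟨w'⟩
  have hinr : ∀ p, ∃ u : V, (diamondStep G).Reachable p (Sum.inl u) := by
    rintro (u | ⟨⟨e, he⟩, b⟩)
    · exact ⟨u, SimpleGraph.Reachable.refl _⟩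
    · induction e with
      | _ x y =>
        have : (diamondStep G).Adj (Sum.inr (⟨s(x, y), he⟩, b)) (Sum.inl x) :=
          Sym2.mem_mk_left x y
        exact ⟨x, this.reachable⟩
  have : Nonempty (V ⊕ (G.edgeSet × Bool)) := ⟨Sum.inl hne.some⟩
  refine SimpleGraph.Connected.mk (fun p q => ?_)
  obtain ⟨u, hu⟩ := hinr p
  obtain ⟨v, hv⟩ := hinr q
  exact (hu.trans (key u v)).trans hv.symm

theorem diamondStep_exists_adj {V : Type} {G : SimpleGraph V} (hE : ∀ u, ∃ v, G.Adj u v) :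
    ∀ p, ∃ q, (diamondStep G).Adj p q := by
  rintro (u | ⟨⟨e, he⟩, b⟩)
  · obtain ⟨v, hv⟩ := hE u
    obtain ⟨p, hp, -⟩ := diamondStep_adj_edge G hv
    exact ⟨p, hp⟩
  · induction e with
    | _ x y => exact ⟨Sum.inl x, Sym2.mem_mk_left x y⟩

theorem diamondStep_dist_le_walk {V : Type} {G : SimpleGraph V} (hG : G.Connected) :
    ∀ (k : ℕ) (u v : V) (w : (diamondStep G).Walk (Sum.inl u) (Sum.inl v)),
      w.length ≤ k → 2 * G.dist u v ≤ w.length := by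
  intro k
  induction k using Nat.strong_induction_on with
  | _ k ih =>
    intro u v w hk
    cases w with
    | nil => simp
    | @cons _ p _ h w =>
      rcases p with x | ⟨⟨e, he⟩, b⟩
      · exact h.elim
      · cases w with
        | @cons _ q _ h' w =>
          rcases q with x | q
          · have hux : G.dist u x ≤ 1 := by
              have hu : u ∈ e := h
              have hx : x ∈ e := h'
              by_cases hxu : u = x
              · subst hxu; simp
              · have : e = s(u, x) := ((Sym2.mem_and_mem_iff hxu).1 ⟨hu, hx⟩)
                subst this
                exact (SimpleGraph.dist_eq_one_iff_adj.2 he).le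
            simp only [SimpleGraph.Walk.length_cons] at hk ⊢
            have h1 := ih w.length (by omega) x v w le_rfl
            have h2 := hG.dist_triangle (u := u) (v := x) (w := v)
            omega
          · exact h'.elim

theorem diamondStep_dist {V : Type} {G : SimpleGraph V} (hG : G.Connected) (u v : V) :
    (diamondStep G).dist (Sum.inl u) (Sum.inl v) = 2 * G.dist u v := by
  obtain ⟨w, hw⟩ := hG.exists_walk_length_eq_dist u v
  obtain ⟨w', hw'⟩ := diamondStep_exists_walk G w
  apply le_antisymm
  · rw [← hw, ← hw']
    exact SimpleGraph.dist_le w'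
  · have hr : (diamondStep G).Reachable (Sum.inl u) (Sum.inl v) := ⟨w'⟩
    obtain ⟨w'', h''⟩ := hr.exists_walk_length_eq_dist
    rw [← h'']
    exact diamondStep_dist_le_walk hG _ u v w'' le_rfl

theorem diamondGraph_connected_and (n : ℕ) :
    (diamondGraph n).Connected ∧ ∀ u, ∃ v, (diamondGraph n).Adj u v := by
  induction n with
  | zero =>
    refine ⟨(SimpleGraph.connected_top : (⊤ : SimpleGraph Bool).Connected), fun u => ?_⟩
    exact ⟨(Bool.not u : Bool), (by cases u <;> decide : (⊤ : SimpleGraph Bool).Adj u (Bool.not u))⟩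
  | succ n ih => exact ⟨diamondStep_connected ih.1, diamondStep_exists_adj ih.2⟩

theorem diamondGraph_connected (n : ℕ) : (diamondGraph n).Connected :=
  (diamondGraph_connected_and n).1

/-- The shortest path metric of the diamond graph of level `n`, all of whose edges have length
`2⁻ⁿ`. -/
noncomputable instance diamondMetricSpace (n : ℕ) : MetricSpace (DiamondVertex n) where
  dist u v := (2 : ℝ)⁻¹ ^ n * ((diamondGraph n).dist u v : ℝ)
  dist_self u := by simp
  dist_comm u v := by simp [SimpleGraph.dist_comm]
  dist_triangle u v w := by
    rw [← mul_add]
    gcongr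
    exact_mod_cast (diamondGraph_connected n).dist_triangle
  eq_of_dist_eq_zero {u v} h := by
    have h' : ((diamondGraph n).dist u v : ℝ) = 0 := by simpa using h
    exact (diamondGraph_connected n).dist_eq_zero_iff.1 (by exact_mod_cast h')

theorem diamondIncl_isometry (n : ℕ) : Isometry (diamondIncl n) := by
  refine Isometry.of_dist_eq fun u v => ?_
  change (2 : ℝ)⁻¹ ^ (n + 1) * ((diamondGraph (n + 1)).dist (diamondIncl n u) (diamondIncl n v) : ℝ)
    = (2 : ℝ)⁻¹ ^ n * ((diamondGraph n).dist u v : ℝ)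
  have h : (diamondGraph (n + 1)).dist (diamondIncl n u) (diamondIncl n v)
      = 2 * (diamondGraph n).dist u v := diamondStep_dist (diamondGraph_connected n) u v
  rw [h]
  push_cast
  ring

/-- The infinite diamond `D_ω`: the union (inductive limit) of the increasing sequence of the
vertex sets of the diamond graphs along the isometric inclusions `diamondIncl n`, with the common
extension of their metrics. -/
abbrev DiamondOmega : Type := Metric.InductiveLimit diamondIncl_isometry

/-! ### Bilipschitz embeddings -/

/-- `F` is a `C`-bilipschitz embedding: for some `r > 0`,
`r d(u,v) ≤ d(F u, F v) ≤ r C d(u,v)` for all `u, v`. -/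
def IsBilipschitzEmbedding {A B : Type*} [MetricSpace A] [MetricSpace B] (C : ℝ) (F : A → B) :
    Prop :=
  ∃ r : ℝ, 0 < r ∧ ∀ u v : A,
    r * dist u v ≤ dist (F u) (F v) ∧ dist (F u) (F v) ≤ r * C * dist u v

/-- `A` is bilipschitz embeddable into `B`: there is a `C`-bilipschitz embedding for some `C`. -/
def BilipschitzEmbeddable (A B : Type*) [MetricSpace A] [MetricSpace B] : Prop :=
  ∃ (C : ℝ) (F : A → B), IsBilipschitzEmbedding C F

/-! ### The Radon-Nikodym property and `δ`-trees -/

/-- The Radon-Nikodym property of a Banach space `X`: every countably additive `X`-valued measure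
`ν` of bounded variation which is absolutely continuous with respect to a finite positive measure
`μ` has a Bochner integrable density with respect to `μ`. -/
def HasRadonNikodymProperty (X : Type*) [NormedAddCommGroup X] [NormedSpace ℝ X] : Prop :=
  ∀ (Ω : Type) [MeasurableSpace Ω] (μ : Measure Ω) [IsFiniteMeasure μ] (ν : VectorMeasure Ω X),
    ν.variation Set.univ < ⊤ →
    (∀ s, MeasurableSet s → μ s = 0 → ν s = 0) →
    ∃ g : Ω → X, Integrable g μ ∧ ∀ s, MeasurableSet s → ν s = ∫ t in s, g t ∂μ

/-- A `δ`-tree `x₁, x₂, x₃, …`: the sequence is indexed by the positive integers, so the value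
`x 0` plays no role. -/
def IsDeltaTree {X : Type*} [NormedAddCommGroup X] [NormedSpace ℝ X] (δ : ℝ) (x : ℕ → X) : Prop :=
  ∀ i : ℕ, 1 ≤ i →
    x i = (1 / 2 : ℝ) • (x (2 * i) + x (2 * i + 1)) ∧
    ‖x (2 * i) - x i‖ = ‖x (2 * i + 1) - x i‖ ∧
    δ ≤ ‖x (2 * i + 1) - x i‖

/-- `X` contains a bounded `δ`-tree. -/
def ContainsBoundedDeltaTree (X : Type*) [NormedAddCommGroup X] [NormedSpace ℝ X] (δ : ℝ) :
    Prop :=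
  ∃ x : ℕ → X, IsDeltaTree δ x ∧ ∃ M : ℝ, ∀ i : ℕ, 1 ≤ i → ‖x i‖ ≤ M

/-!
Both halves compare bounded dyadic martingales, that is, bounded families `x i` indexed by the nodes
of the binary tree with `x i = (x (2 i) + x (2 i + 1)) / 2`.

For the first half, let `F` be a bilipschitz embedding of the infinite diamond. The slopes of `F`
along the edges of the diamond graphs are bounded. If an edge `uv` is replaced by the quadrilateral
`u, a, v, b`, then the slope along `uv` is the mean of the slopes along `ua` and `av`, and also the
mean of those along `ub` and `bv`; since `F a` and `F b` are far apart, one of the two paths gives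
slopes at a distance at least `r` from the slope along `uv`. So the slopes contain a bounded
`δ`-tree (`BilipschitzEmbeddable.exists_containsBoundedDeltaTree`). A bounded dyadic martingale
consists of the averages over dyadic intervals of a vector measure on `[0, 1)`. If the space has the
Radon-Nikodym property, this measure has an integrable density; approximating the density in `L¹` by
a continuous function one sees that the increments of the martingale tend to `0` in the mean
(`HasRadonNikodymProperty.exists_increment_lt`). This excludes `δ`-trees.

For the second half it suffices to find a Banach space without bounded `δ`-trees which fails the
Radon-Nikodym property. Let `treeFunctions` be the set of the functions `G` on the binary tree which
are bounded by `1` and whose jumps `G i - G (i / 2)` vanish except on a sparse sequence of levels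
`jumpLevel l`, where they form a vector in the unit ball of `ℓ^p` with `p = jumpExponent l`, an
exponent growing very fast with `l`. The space `treeSpace` is the closed span of the evaluations at
the nodes, with the norm of uniform convergence on `treeFunctions`. The evaluations have norm at most
`1`, while the differences between the evaluations at the nodes of one jump level and at their
parents span a finite-dimensional `ℓ^q` space with `q` close to `1`.

The gaps between the jump levels are so large that, by the power mean inequality, the mean of the
evaluations at the descendants of a node converges when one descends in the tree. The limits form a
bounded dyadic martingale whose increments do not become small at the jump levels, and so
`treeSpace` fails the Radon-Nikodym property (`not_hasRadonNikodymProperty_treeSpace`).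

There is no bounded `δ`-tree in `treeSpace` (`not_containsBoundedDeltaTree_treeSpace`). Let `x m` be
a node of such a tree with almost maximal norm, and choose `l` such that `x m` lives essentially on
the levels up to `jumpLevel l`. The key is the estimate `card_mul_norm_add_le_sum_norm`: for a
number of descendants of `x m` bounded in terms of `jumpExponent (l + 1)`, their parts beyond the
level `jumpLevel l` increase the mean of the norms by a fixed proportion of their mean size. To
prove it, one perturbs a tree function norming `x m` by tree functions `T w` testing these parts;
subtracting from all the `T w` their pointwise maximum (or minimum) `U` does not change the mean
effect, and makes the sign of the perturbation such that the bound by `1` is preserved, while the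
jumps of `U` are controlled in `ℓ^p` since `p` is large compared with the logarithm of the number of
the functions `T w`. Since the norm of `x m` is almost maximal, the parts beyond the level are small
for `jumpExponent (l + 1)` generations, and the `δ`-tree is essentially one of that height in a space
of dimension at most `2 ^ (jumpLevel l + 1)`, which is impossible by the parallelogram identity in
coordinates.
-/

open Filter Topology Set BoundedContinuousFunction

/-! ### Dyadic martingales and the Radon-Nikodym property -/

/-- The index `i` of the dyadic interval `[i / 2 ^ k, (i + 1) / 2 ^ k)` containing `t ≥ 0`. -/
noncomputable def dyadicIndex (k : ℕ) (t : ℝ) : ℕ := ⌊(2 : ℝ) ^ k * t⌋₊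

theorem dyadicIndex_succ_div_two (k : ℕ) (t : ℝ) : dyadicIndex (k + 1) t / 2 = dyadicIndex k t := by
  unfold dyadicIndex
  rw [← Nat.floor_div_ofNat]
  congr 1
  rw [pow_succ]
  ring

theorem dyadicIndex_natCast_div (k i : ℕ) : dyadicIndex k ((i : ℝ) / 2 ^ k) = i := by
  unfold dyadicIndex
  rw [mul_div_cancel₀ _ (by positivity)]
  exact Nat.floor_natCast i

theorem measurable_dyadicIndex (k : ℕ) : Measurable (dyadicIndex k) :=
  Nat.measurable_floor.comp (measurable_const.mul measurable_id)

theorem dyadicIndex_eq_iff {k i : ℕ} {t : ℝ} (ht : 0 ≤ t) :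
    dyadicIndex k t = i ↔ t ∈ Ico ((i : ℝ) / 2 ^ k) ((i + 1) / 2 ^ k) := by
  unfold dyadicIndex
  have h : (0 : ℝ) < 2 ^ k := by positivity
  rw [Nat.floor_eq_iff (by positivity), mem_Ico, div_le_iff₀ h, lt_div_iff₀ h, mul_comm t]

theorem dyadicIndex_lt {k : ℕ} {t : ℝ} (ht : t ∈ Ico (0 : ℝ) 1) : dyadicIndex k t < 2 ^ k := by
  unfold dyadicIndex
  have h : (0 : ℝ) < 2 ^ k := by positivity
  rw [Nat.floor_lt (mul_nonneg h.le ht.1)]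
  push_cast
  nlinarith [ht.2]

/-- The algebra of the sets which are unions of dyadic intervals of some fixed level. -/
def dyadicRing : Set (Set ℝ) := {A | ∃ (k : ℕ) (S : Set ℕ), A = dyadicIndex k ⁻¹' S}

theorem exists_preimage_dyadicIndex_of_le {k l : ℕ} (hkl : k ≤ l) (S : Set ℕ) :
    ∃ S' : Set ℕ, dyadicIndex k ⁻¹' S = dyadicIndex l ⁻¹' S' := by
  induction l, hkl using Nat.le_induction with
  | base => exact ⟨S, rfl⟩
  | succ l _ ih =>
    obtain ⟨S', h⟩ := ih
    refine ⟨(· / 2) ⁻¹' S', ?_⟩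
    rw [h]
    ext t
    simp only [mem_preimage, dyadicIndex_succ_div_two]

theorem isSetRing_dyadicRing : IsSetRing dyadicRing where
  empty_mem := ⟨0, ∅, by simp⟩
  union_mem := by
    rintro _ _ ⟨k, S, rfl⟩ ⟨l, S', rfl⟩
    obtain ⟨U, hU⟩ := exists_preimage_dyadicIndex_of_le (le_max_left k l) S
    obtain ⟨U', hU'⟩ := exists_preimage_dyadicIndex_of_le (le_max_right k l) S'
    exact ⟨max k l, U ∪ U', by rw [hU, hU', preimage_union]⟩
  sdiff_mem := by
    rintro _ _ ⟨k, S, rfl⟩ ⟨l, S', rfl⟩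
    obtain ⟨U, hU⟩ := exists_preimage_dyadicIndex_of_le (le_max_left k l) S
    obtain ⟨U', hU'⟩ := exists_preimage_dyadicIndex_of_le (le_max_right k l) S'
    exact ⟨max k l, U \ U', by rw [hU, hU', preimage_sdiff]⟩

/-- Lebesgue measure on the unit interval `[0, 1)`. -/
noncomputable abbrev unitMeasure : Measure ℝ := volume.restrict (Ico (0 : ℝ) 1)

theorem measurableSet_dyadicIndex_preimage (k : ℕ) (S : Set ℕ) :
    MeasurableSet (dyadicIndex k ⁻¹' S) :=
  measurable_dyadicIndex k (MeasurableSet.of_discrete)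

theorem unitMeasure_real_dyadicIndex_singleton {k i : ℕ} (hi : i < 2 ^ k) :
    unitMeasure.real (dyadicIndex k ⁻¹' {i}) = (2 ^ k : ℝ)⁻¹ := by
  have h : (0 : ℝ) < 2 ^ k := by positivity
  have hi' : (i : ℝ) + 1 ≤ 2 ^ k := by exact_mod_cast hi
  have e : dyadicIndex k ⁻¹' {i} ∩ Ico (0 : ℝ) 1 = Ico ((i : ℝ) / 2 ^ k) ((i + 1) / 2 ^ k) := by
    ext t
    constructor
    · rintro ⟨h1, h2⟩
      exact (dyadicIndex_eq_iff h2.1).1 h1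
    · intro ht
      have h0 : 0 ≤ t := le_trans (by positivity) ht.1
      refine ⟨(dyadicIndex_eq_iff h0).2 ht, h0, ht.2.trans_le ?_⟩
      rw [div_le_one h]
      exact hi'
  rw [measureReal_restrict_apply (measurableSet_dyadicIndex_preimage k _), e,
    Real.volume_real_Ico_of_le (by gcongr; linarith)]
  field_simp
  ring

theorem unitMeasure_real_dyadicIndex_preimage (k : ℕ) (S : Set ℕ) [DecidablePred (· ∈ S)] :
    unitMeasure.real (dyadicIndex k ⁻¹' S)
      = ∑ i ∈ Finset.range (2 ^ k), if i ∈ S then (2 ^ k : ℝ)⁻¹ else 0 := by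
  have e : unitMeasure.real (dyadicIndex k ⁻¹' S) = unitMeasure.real
      (⋃ i ∈ (Finset.range (2 ^ k)).filter (· ∈ S), dyadicIndex k ⁻¹' {i}) := by
    apply measureReal_congr
    have := ae_restrict_mem (μ := volume) (measurableSet_Ico (a := (0 : ℝ)) (b := 1))
    filter_upwards [this] with t ht
    have := dyadicIndex_lt (k := k) ht
    refine propext ?_
    change t ∈ dyadicIndex k ⁻¹' S ↔
      t ∈ ⋃ i ∈ (Finset.range (2 ^ k)).filter (· ∈ S), dyadicIndex k ⁻¹' {i}
    simp [this]
  rw [e, measureReal_biUnion_finset, Finset.sum_filter]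
  · refine Finset.sum_congr rfl fun i hi => ?_
    rw [unitMeasure_real_dyadicIndex_singleton (Finset.mem_range.1 hi)]
  · intro i _ j _ hij
    refine Disjoint.preimage _ ?_
    simpa using hij
  · exact fun i _ => measurableSet_dyadicIndex_preimage k _

section DyadicMartingale

variable {X : Type*} [NormedAddCommGroup X] [NormedSpace ℝ X]

open Classical in
/-- The integral over `A` of the step function with value `x (2 ^ k + i)` on the `i`-th dyadic
interval of level `k`, for a union `A` of dyadic intervals of level `k`. -/
noncomputable def dyadicSum (x : ℕ → X) (k : ℕ) (A : Set ℝ) : X :=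
  ∑ i ∈ Finset.range (2 ^ k), if (i : ℝ) / 2 ^ k ∈ A then (2 ^ k : ℝ)⁻¹ • x (2 ^ k + i) else 0

theorem Finset.sum_range_two_mul {M : Type*} [AddCommMonoid M] (f : ℕ → M) (n : ℕ) :
    ∑ i ∈ Finset.range (2 * n), f i = ∑ i ∈ Finset.range n, (f (2 * i) + f (2 * i + 1)) := by
  induction n with
  | zero => simp
  | succ n ih =>
    rw [Nat.mul_succ, Finset.sum_range_succ, Finset.sum_range_succ, ih, Finset.sum_range_succ,
      add_assoc]

theorem dyadicSum_succ {x : ℕ → X}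
    (hx : ∀ i, 1 ≤ i → x i = (1 / 2 : ℝ) • (x (2 * i) + x (2 * i + 1)))
    (k : ℕ) (S : Set ℕ) :
    dyadicSum x (k + 1) (dyadicIndex k ⁻¹' S) = dyadicSum x k (dyadicIndex k ⁻¹' S) := by
  classical
  unfold dyadicSum
  rw [pow_succ' 2 k, Finset.sum_range_two_mul]
  refine Finset.sum_congr rfl fun i _ => ?_
  have h (j : ℕ) : ((j : ℝ) / 2 ^ (k + 1) ∈ dyadicIndex k ⁻¹' S) ↔ j / 2 ∈ S := by
    rw [mem_preimage, ← dyadicIndex_succ_div_two, dyadicIndex_natCast_div]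
  have h' : ((i : ℝ) / 2 ^ k ∈ dyadicIndex k ⁻¹' S) ↔ i ∈ S := by
    rw [mem_preimage, dyadicIndex_natCast_div]
  have e1 : 2 * i / 2 = i := by omega
  have e2 : (2 * i + 1) / 2 = i := by omega
  have e3 : 2 * 2 ^ k + 2 * i = 2 * (2 ^ k + i) := by ring
  have e4 : 2 * 2 ^ k + (2 * i + 1) = 2 * (2 ^ k + i) + 1 := by ring
  simp only [h, h', e1, e2, e3, e4, hx (2 ^ k + i) (le_add_right Nat.one_le_two_pow)]
  split_ifs
  · rw [pow_succ, mul_inv, smul_smul, ← smul_add]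
    norm_num
  · simp

theorem dyadicSum_eq_of_le {x : ℕ → X}
    (hx : ∀ i, 1 ≤ i → x i = (1 / 2 : ℝ) • (x (2 * i) + x (2 * i + 1)))
    {k l : ℕ} (hkl : k ≤ l) (S : Set ℕ) :
    dyadicSum x l (dyadicIndex k ⁻¹' S) = dyadicSum x k (dyadicIndex k ⁻¹' S) := by
  induction l, hkl using Nat.le_induction with
  | base => rfl
  | succ l hl ih =>
    rw [← ih]
    obtain ⟨S', h⟩ := exists_preimage_dyadicIndex_of_le hl S
    rw [h, dyadicSum_succ hx]

/-- A bounded dyadic martingale is the martingale of the averages of a vector measure. -/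
theorem exists_vectorMeasure_of_dyadicMartingale [CompleteSpace X] {x : ℕ → X} {M : ℝ}
    (hx : ∀ i, 1 ≤ i → x i = (1 / 2 : ℝ) • (x (2 * i) + x (2 * i + 1)))
    (hM : ∀ i, 1 ≤ i → ‖x i‖ ≤ M) :
    ∃ ν : VectorMeasure ℝ X, (∀ A, ‖ν A‖ₑ ≤ (ENNReal.ofReal M • unitMeasure) A) ∧
      ∀ k i, i < 2 ^ k → ν (dyadicIndex k ⁻¹' {i}) = (2 ^ k : ℝ)⁻¹ • x (2 ^ k + i) := by
  classical
  have hM0 : 0 ≤ M := (norm_nonneg _).trans (hM 1 le_rfl)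
  let m₀ : Set ℝ → X := fun A => limUnder atTop fun k => dyadicSum x k A
  have hm₀ (k : ℕ) (S : Set ℕ) :
      m₀ (dyadicIndex k ⁻¹' S) = dyadicSum x k (dyadicIndex k ⁻¹' S) := by
    refine Tendsto.limUnder_eq ?_
    refine tendsto_const_nhds.congr' ?_
    filter_upwards [eventually_ge_atTop k] with l hl
    exact (dyadicSum_eq_of_le hx hl S).symm
  let m : AddContent X dyadicRing := isSetRing_dyadicRing.addContent_of_union m₀
    (by simpa [dyadicSum] using hm₀ 0 ∅)
    (by
      rintro _ _ ⟨k, S, rfl⟩ ⟨l, S', rfl⟩ hd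
      obtain ⟨U, hU⟩ := exists_preimage_dyadicIndex_of_le (le_max_left k l) S
      obtain ⟨U', hU'⟩ := exists_preimage_dyadicIndex_of_le (le_max_right k l) S'
      rw [hU, hU'] at hd ⊢
      rw [← preimage_union, hm₀, hm₀, hm₀, dyadicSum, dyadicSum, dyadicSum,
        ← Finset.sum_add_distrib]
      refine Finset.sum_congr rfl fun i _ => ?_
      have h : ¬ ((i : ℝ) / 2 ^ max k l ∈ dyadicIndex (max k l) ⁻¹' U ∧
          (i : ℝ) / 2 ^ max k l ∈ dyadicIndex (max k l) ⁻¹' U') :=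
        fun h => Set.disjoint_left.1 hd h.1 h.2
      rw [preimage_union, mem_union]
      by_cases h1 : (i : ℝ) / 2 ^ max k l ∈ dyadicIndex (max k l) ⁻¹' U
      · rw [if_pos (Or.inl h1), if_pos h1, if_neg fun h2 => h ⟨h1, h2⟩, add_zero]
      · simp only [h1, false_or, if_false, zero_add])
  have hle : ∀ A ∈ dyadicRing, ‖m A‖ₑ ≤ (ENNReal.ofReal M • unitMeasure) A := by
    rintro _ ⟨k, S, rfl⟩
    change ‖m₀ _‖ₑ ≤ _
    rw [hm₀, Measure.smul_apply, smul_eq_mul, ← ofReal_measureReal, ← ENNReal.ofReal_mul hM0,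
      ← ofReal_norm]
    refine ENNReal.ofReal_le_ofReal ?_
    rw [unitMeasure_real_dyadicIndex_preimage, Finset.mul_sum]
    refine norm_sum_le_of_le _ fun i _ => ?_
    rw [mem_preimage, dyadicIndex_natCast_div]
    split_ifs
    · rw [norm_smul, norm_inv, norm_pow, Real.norm_ofNat, mul_comm]
      gcongr
      exact hM _ (le_add_right Nat.one_le_two_pow)
    · simp
  have : IsFiniteMeasure (ENNReal.ofReal M • unitMeasure) :=
    Measure.smul_finite _ ENNReal.ofReal_ne_top
  obtain ⟨ν, h1, h2⟩ := VectorMeasure.exists_extension_of_isSetSemiring_of_le_measure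
    isSetRing_dyadicRing.isSetSemiring hle
    (by rintro _ ⟨k, S, rfl⟩; exact measurableSet_dyadicIndex_preimage k S)
  refine ⟨ν, h2, fun k i hi => ?_⟩
  rw [h1 _ ⟨k, {i}, rfl⟩]
  change m₀ _ = _
  rw [hm₀, dyadicSum]
  simp_rw [mem_preimage, dyadicIndex_natCast_div, mem_singleton_iff]
  rw [Finset.sum_ite_eq' _ i, if_pos (Finset.mem_range.2 hi)]

/-- In a space with the Radon-Nikodym property a bounded dyadic martingale has, at all late levels,
small increments at some nodes: it consists of the averages of an integrable function. -/
theorem HasRadonNikodymProperty.exists_increment_lt [CompleteSpace X]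
    (hX : HasRadonNikodymProperty X) {x : ℕ → X} {M δ : ℝ} (hδ : 0 < δ)
    (hx : ∀ i, 1 ≤ i → x i = (1 / 2 : ℝ) • (x (2 * i) + x (2 * i + 1)))
    (hM : ∀ i, 1 ≤ i → ‖x i‖ ≤ M) :
    ∃ k₀, ∀ k, k₀ ≤ k → ∃ i < 2 ^ k, ‖x (2 * (2 ^ k + i)) - x (2 ^ k + i)‖ < δ := by
  obtain ⟨ν, hν, hνx⟩ := exists_vectorMeasure_of_dyadicMartingale hx hM
  have hvar : ν.variation univ < ⊤ := by
    refine (VectorMeasure.variation_le_of_forall_enorm_le (fun s _ => hν s) univ).trans_lt ?_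
    rw [Measure.smul_apply, smul_eq_mul]
    exact ENNReal.mul_lt_top ENNReal.ofReal_lt_top (measure_lt_top _ _)
  obtain ⟨g, hg, hgν⟩ := hX ℝ unitMeasure ν hvar fun s _ h0 => by
    have := hν s
    rw [Measure.smul_apply, h0, smul_zero, nonpos_iff_eq_zero] at this
    simpa using this
  obtain ⟨h, hsupp, hgh, hcont, hint⟩ := hg.exists_hasCompactSupport_integral_sub_le
    (ε := δ / 4) (by positivity)
  obtain ⟨r, hr, huc⟩ := Metric.uniformContinuous_iff.1
    (hsupp.uniformContinuous_of_continuous hcont) (δ / 4) (by positivity)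
  obtain ⟨k₀, hk₀⟩ := exists_pow_lt_of_lt_one hr (by norm_num : (1 / 2 : ℝ) < 1)
  refine ⟨k₀, fun k hk => ?_⟩
  by_contra! hcon
  have h2k : (0 : ℝ) < 2 ^ k := by positivity
  have hk' : ((2 : ℝ) ^ k)⁻¹ < r := by
    refine lt_of_le_of_lt ?_ hk₀
    rw [one_div, inv_pow]
    gcongr
    norm_num
  -- the sum over the level of the inequalities comparing an increment of `x` with the
  -- approximating continuous function `h`, which is almost constant on each interval
  have key : ∀ i < 2 ^ k, (2 ^ k : ℝ)⁻¹ * δ ≤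
      (∫ t in dyadicIndex k ⁻¹' {i}, ‖g t - h t‖ ∂unitMeasure) + (2 ^ k : ℝ)⁻¹ * (δ / 4) := by
    intro i hi
    set c : X := h ((i : ℝ) / 2 ^ k)
    have hosc : ∀ᵐ t ∂unitMeasure, t ∈ dyadicIndex k ⁻¹' {i} → ‖h t - c‖ ≤ δ / 4 := by
      have := ae_restrict_mem (μ := volume) (measurableSet_Ico (a := (0 : ℝ)) (b := 1))
      filter_upwards [this] with t ht hti
      have hti' := (dyadicIndex_eq_iff ht.1).1 hti
      rw [← dist_eq_norm]
      refine (huc ?_).le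
      rw [Real.dist_eq, abs_of_nonneg (by linarith [hti'.1])]
      have := hti'.2
      rw [add_div, one_div] at this
      linarith
    have hunion : dyadicIndex k ⁻¹' {i}
        = dyadicIndex (k + 1) ⁻¹' {2 * i} ∪ dyadicIndex (k + 1) ⁻¹' {2 * i + 1} := by
      ext t
      simp only [mem_preimage, mem_singleton_iff, mem_union, ← dyadicIndex_succ_div_two k t]
      omega
    have hdisj : Disjoint (dyadicIndex (k + 1) ⁻¹' {2 * i})
        (dyadicIndex (k + 1) ⁻¹' {2 * i + 1}) := Disjoint.preimage _ (by simp)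
    have hgc : Integrable (fun t => g t - c) unitMeasure := hg.sub (integrable_const c)
    have hhc : Integrable (fun t => h t - c) unitMeasure := hint.sub (integrable_const c)
    have hval : ∀ j < 2 ^ (k + 1), ∫ t in dyadicIndex (k + 1) ⁻¹' {j}, (g t - c) ∂unitMeasure
        = (2 ^ (k + 1) : ℝ)⁻¹ • (x (2 ^ (k + 1) + j) - c) := by
      intro j hj
      rw [integral_sub hg.integrableOn (integrable_const c).integrableOn,
        ← hgν _ (measurableSet_dyadicIndex_preimage _ _), hνx _ _ hj, setIntegral_const,
        unitMeasure_real_dyadicIndex_singleton hj, smul_sub]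
    have hpow : 2 ^ (k + 1) = 2 * 2 ^ k := pow_succ' 2 k
    have e3 : 2 * 2 ^ k + 2 * i = 2 * (2 ^ k + i) := by ring
    have e4 : 2 * 2 ^ k + (2 * i + 1) = 2 * (2 ^ k + i) + 1 := by ring
    have hinc : (2 ^ k : ℝ)⁻¹ • (x (2 * (2 ^ k + i)) - x (2 ^ k + i))
        = (∫ t in dyadicIndex (k + 1) ⁻¹' {2 * i}, (g t - c) ∂unitMeasure)
          - ∫ t in dyadicIndex (k + 1) ⁻¹' {2 * i + 1}, (g t - c) ∂unitMeasure := by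
      rw [hval _ (by omega), hval _ (by omega), hpow, e3, e4, ← smul_sub,
        hx (2 ^ k + i) (le_add_right Nat.one_le_two_pow), pow_succ, mul_inv]
      module
    have hle : (2 ^ k : ℝ)⁻¹ * δ ≤ ∫ t in dyadicIndex k ⁻¹' {i}, ‖g t - c‖ ∂unitMeasure := by
      calc (2 ^ k : ℝ)⁻¹ * δ ≤ ‖(2 ^ k : ℝ)⁻¹ • (x (2 * (2 ^ k + i)) - x (2 ^ k + i))‖ := by
            rw [norm_smul, norm_inv, norm_pow, Real.norm_ofNat]
            gcongr
            exact hcon i hi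
        _ ≤ _ := by
            rw [hinc, hunion, setIntegral_union hdisj (measurableSet_dyadicIndex_preimage _ _)
              hgc.norm.integrableOn hgc.norm.integrableOn]
            refine (norm_sub_le _ _).trans ?_
            gcongr <;> exact norm_integral_le_integral_norm _
    have hcc : ∫ t in dyadicIndex k ⁻¹' {i}, ‖h t - c‖ ∂unitMeasure ≤ (2 ^ k : ℝ)⁻¹ * (δ / 4) := by
      have := setIntegral_mono_on_ae hhc.norm.integrableOn
        (integrable_const (δ / 4)).integrableOn (measurableSet_dyadicIndex_preimage k {i}) hosc
      refine this.trans_eq ?_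
      rw [setIntegral_const, unitMeasure_real_dyadicIndex_singleton hi, smul_eq_mul]
    calc (2 ^ k : ℝ)⁻¹ * δ ≤ ∫ t in dyadicIndex k ⁻¹' {i}, ‖g t - c‖ ∂unitMeasure := hle
      _ ≤ ∫ t in dyadicIndex k ⁻¹' {i}, (‖g t - h t‖ + ‖h t - c‖) ∂unitMeasure := by
          refine integral_mono hgc.norm.integrableOn
            ((hg.sub hint).norm.add hhc.norm).integrableOn fun t => ?_
          exact norm_sub_le_norm_sub_add_norm_sub _ _ _
      _ = (∫ t in dyadicIndex k ⁻¹' {i}, ‖g t - h t‖ ∂unitMeasure)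
          + ∫ t in dyadicIndex k ⁻¹' {i}, ‖h t - c‖ ∂unitMeasure :=
          integral_add (hg.sub hint).norm.integrableOn hhc.norm.integrableOn
      _ ≤ _ := by gcongr
  have hsum := Finset.sum_le_sum fun i hi => key i (Finset.mem_range.1 hi)
  rw [Finset.sum_add_distrib, Finset.sum_const, Finset.sum_const, Finset.card_range, nsmul_eq_mul,
    nsmul_eq_mul, ← integral_biUnion_finset] at hsum
  · have hle : ∫ t in ⋃ i ∈ Finset.range (2 ^ k), dyadicIndex k ⁻¹' {i}, ‖g t - h t‖ ∂unitMeasure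
        ≤ ∫ t, ‖g t - h t‖ ∂unitMeasure :=
      setIntegral_le_integral (hg.sub hint).norm (Eventually.of_forall fun t => norm_nonneg _)
    push_cast at hsum
    rw [← mul_assoc, ← mul_assoc, mul_inv_cancel₀ h2k.ne'] at hsum
    linarith
  · exact fun i _ => measurableSet_dyadicIndex_preimage k _
  · intro i _ j _ hij
    exact Disjoint.preimage _ (by simpa using hij)
  · exact fun i _ => (hg.sub hint).norm.integrableOn

end DyadicMartingale

/-- A space with the Radon-Nikodym property contains no bounded `δ`-tree. -/
theorem HasRadonNikodymProperty.not_containsBoundedDeltaTree {X : Type*} [NormedAddCommGroup X]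
    [NormedSpace ℝ X] [CompleteSpace X] (hX : HasRadonNikodymProperty X) {δ : ℝ} (hδ : 0 < δ) :
    ¬ ContainsBoundedDeltaTree X δ := by
  rintro ⟨x, hx, M, hM⟩
  obtain ⟨k, hk⟩ := hX.exists_increment_lt hδ (fun i hi => (hx i hi).1) hM
  obtain ⟨i, -, hi⟩ := hk k le_rfl
  obtain ⟨-, h2, h3⟩ := hx (2 ^ k + i) (le_add_right Nat.one_le_two_pow)
  linarith

/-! ### Slopes along the edges of the diamond graphs -/

/-- The labelling `t` of the infinite binary tree (with nodes `1, 2, 3, …`, the children of `i`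
being `2 * i` and `2 * i + 1`) with `t 1 = a`, `t (2 * i) = L (t i)` and
`t (2 * i + 1) = R (t i)`. -/
def binaryTree {α : Type*} (a : α) (L R : α → α) : ℕ → α
  | 0 => a
  | 1 => a
  | n + 2 => if n % 2 = 0 then L (binaryTree a L R ((n + 2) / 2))
      else R (binaryTree a L R ((n + 2) / 2))

theorem binaryTree_two_mul {α : Type*} (a : α) (L R : α → α) {i : ℕ} (hi : 1 ≤ i) :
    binaryTree a L R (2 * i) = L (binaryTree a L R i) := by
  obtain ⟨j, rfl⟩ := Nat.exists_eq_add_of_le' hi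
  rw [show 2 * (j + 1) = 2 * j + 2 by ring, binaryTree, if_pos (by omega)]
  congr 2
  omega

theorem binaryTree_two_mul_add_one {α : Type*} (a : α) (L R : α → α) {i : ℕ} (hi : 1 ≤ i) :
    binaryTree a L R (2 * i + 1) = R (binaryTree a L R i) := by
  obtain ⟨j, rfl⟩ := Nat.exists_eq_add_of_le' hi
  rw [show 2 * (j + 1) + 1 = (2 * j + 1) + 2 by ring, binaryTree, if_neg (by omega)]
  congr 2
  omega

/-- A bounded set each of whose elements is the midpoint of two others at a distance at least `δ`
from it contains a `δ`-tree: choose such a pair at every node. -/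
theorem containsBoundedDeltaTree_of_forall_exists_split {X : Type*} [NormedAddCommGroup X]
    [NormedSpace ℝ X] {S : Set X} {δ M : ℝ} (hne : S.Nonempty) (hM : ∀ s ∈ S, ‖s‖ ≤ M)
    (hS : ∀ s ∈ S, ∃ d, δ ≤ ‖d‖ ∧ s + d ∈ S ∧ s - d ∈ S) : ContainsBoundedDeltaTree X δ := by
  choose! d hd h1 h2 using hS
  obtain ⟨s₀, hs₀⟩ := hne
  set x := binaryTree s₀ (fun s => s + d s) (fun s => s - d s) with hx
  have hmem : ∀ i, 1 ≤ i → x i ∈ S := by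
    intro i
    induction i using Nat.strong_induction_on with
    | _ i ih =>
      intro hi
      obtain rfl | hi' := hi.eq_or_lt
      · simpa [hx, binaryTree] using hs₀
      · obtain ⟨j, rfl | rfl⟩ := Nat.even_or_odd' i
        · rw [hx, binaryTree_two_mul _ _ _ (by omega)]
          exact h1 _ (ih j (by omega) (by omega))
        · rw [hx, binaryTree_two_mul_add_one _ _ _ (by omega)]
          exact h2 _ (ih j (by omega) (by omega))
  refine ⟨x, fun i hi => ?_, M, fun i hi => hM _ (hmem i hi)⟩
  have e1 : x (2 * i) = x i + d (x i) := binaryTree_two_mul _ _ _ hi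
  have e2 : x (2 * i + 1) = x i - d (x i) := binaryTree_two_mul_add_one _ _ _ hi
  refine ⟨?_, ?_, ?_⟩
  · rw [e1, e2]
    module
  · rw [e1, e2, add_sub_cancel_left, sub_sub_cancel_left, norm_neg]
  · rw [e2, sub_sub_cancel_left, norm_neg]
    exact hd _ (hmem i hi)

theorem dist_eq_inv_two_pow_of_adj {n : ℕ} {u v : DiamondVertex n} (h : (diamondGraph n).Adj u v) :
    dist u v = (2 : ℝ)⁻¹ ^ n := by
  change (2 : ℝ)⁻¹ ^ n * ((diamondGraph n).dist u v : ℝ) = _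
  rw [SimpleGraph.dist_eq_one_iff_adj.2 h]
  simp

/-- An edge of a diamond graph has two distinct midpoints in the next diamond graph, and these are
as far from each other as the endpoints of the edge. -/
theorem exists_midpoints_of_adj {n : ℕ} {u v : DiamondVertex n} (h : (diamondGraph n).Adj u v) :
    ∃ a : Bool → DiamondVertex (n + 1),
      (∀ i, (diamondGraph (n + 1)).Adj (diamondIncl n u) (a i) ∧
        (diamondGraph (n + 1)).Adj (a i) (diamondIncl n v)) ∧
      (2 : ℝ)⁻¹ ^ n ≤ dist (a true) (a false) := by
  let a : Bool → DiamondVertex (n + 1) := fun b =>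
    (Sum.inr (⟨s(u, v), h⟩, b) : (diamondData n).1 ⊕ ((diamondData n).2.edgeSet × Bool))
  refine ⟨a, fun i => ⟨Sym2.mem_mk_left u v, Sym2.mem_mk_right u v⟩, ?_⟩
  have hne : a true ≠ a false := by
    intro h'
    have := congrArg Prod.snd (Sum.inr.inj h')
    exact absurd this (by simp)
  have h0 : (diamondGraph (n + 1)).dist (a true) (a false) ≠ 0 := fun h' =>
    hne ((diamondGraph_connected (n + 1)).dist_eq_zero_iff.1 h')
  have h1 : (diamondGraph (n + 1)).dist (a true) (a false) ≠ 1 := fun h' =>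
    (SimpleGraph.dist_eq_one_iff_adj.1 h' : False)
  have h2 : 2 ≤ (diamondGraph (n + 1)).dist (a true) (a false) := by omega
  change _ ≤ (2 : ℝ)⁻¹ ^ (n + 1) * ((diamondGraph (n + 1)).dist (a true) (a false) : ℝ)
  have h3 : (2 : ℝ) ≤ ((diamondGraph (n + 1)).dist (a true) (a false) : ℝ) := by exact_mod_cast h2
  calc (2 : ℝ)⁻¹ ^ n = (2 : ℝ)⁻¹ ^ (n + 1) * 2 := by rw [pow_succ]; ring
    _ ≤ _ := by gcongr

/-- The slopes of a bilipschitz embedding of the infinite diamond along the edges of the diamond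
graphs form a bounded set in which each element `s` is the midpoint of two others at a distance at
least `r` from `s`: the slopes along the two halves of one of the two paths replacing an edge. -/
theorem BilipschitzEmbeddable.exists_containsBoundedDeltaTree {X : Type*} [NormedAddCommGroup X]
    [NormedSpace ℝ X] (h : BilipschitzEmbeddable DiamondOmega X) :
    ∃ δ : ℝ, 0 < δ ∧ ContainsBoundedDeltaTree X δ := by
  obtain ⟨C, F, r, hr, hF⟩ := h
  refine ⟨r, hr, ?_⟩
  let f (n : ℕ) (u : DiamondVertex n) : X := F (Metric.toInductiveLimit diamondIncl_isometry n u)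
  have hf (n : ℕ) (u : DiamondVertex n) : f (n + 1) (diamondIncl n u) = f n u :=
    congrArg F (congrFun (Metric.toInductiveLimit_commute diamondIncl_isometry n) u)
  have hlow (n : ℕ) (u v : DiamondVertex n) : r * dist u v ≤ ‖f n u - f n v‖ := by
    have := (hF (Metric.toInductiveLimit diamondIncl_isometry n u)
      (Metric.toInductiveLimit diamondIncl_isometry n v)).1
    rwa [(Metric.toInductiveLimit_isometry diamondIncl_isometry n).dist_eq, dist_eq_norm] at this
  have hup (n : ℕ) (u v : DiamondVertex n) : ‖f n u - f n v‖ ≤ r * C * dist u v := by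
    have := (hF (Metric.toInductiveLimit diamondIncl_isometry n u)
      (Metric.toInductiveLimit diamondIncl_isometry n v)).2
    rwa [(Metric.toInductiveLimit_isometry diamondIncl_isometry n).dist_eq, dist_eq_norm] at this
  have h2 (n : ℕ) : (2 : ℝ) ^ n * (2 : ℝ)⁻¹ ^ n = 1 := by
    rw [← mul_pow, mul_inv_cancel₀ two_ne_zero, one_pow]
  refine containsBoundedDeltaTree_of_forall_exists_split (M := r * C)
    (S := {s | ∃ (n : ℕ) (u v : DiamondVertex n), (diamondGraph n).Adj u v ∧
      s = (2 : ℝ) ^ n • (f n v - f n u)}) ?_ ?_ ?_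
  · exact ⟨_, 0, (true : Bool), (false : Bool),
      (by decide : (⊤ : SimpleGraph Bool).Adj true false), rfl⟩
  · rintro _ ⟨n, u, v, huv, rfl⟩
    rw [norm_smul, norm_pow, Real.norm_ofNat]
    have := hup n v u
    rw [dist_eq_inv_two_pow_of_adj huv.symm] at this
    calc (2 : ℝ) ^ n * ‖f n v - f n u‖ ≤ 2 ^ n * (r * C * (2 : ℝ)⁻¹ ^ n) := by gcongr
      _ = r * C * (2 ^ n * (2 : ℝ)⁻¹ ^ n) := by ring
      _ = r * C := by rw [h2, mul_one]
  · rintro _ ⟨n, u, v, huv, rfl⟩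
    obtain ⟨a, ha, hdist⟩ := exists_midpoints_of_adj huv
    set s := (2 : ℝ) ^ n • (f n v - f n u) with hs
    -- the two candidates for the increment of the slope
    let d (i : Bool) : X := (2 : ℝ) ^ (n + 1) • (f (n + 1) (a i) - f n u) - s
    have hd : 2 * r ≤ ‖d true - d false‖ := by
      have e : d true - d false = (2 : ℝ) ^ (n + 1) • (f (n + 1) (a true) - f (n + 1) (a false)) := by
        simp only [d]
        module
      rw [e, norm_smul, norm_pow, Real.norm_ofNat]
      calc 2 * r = 2 ^ (n + 1) * (r * (2 : ℝ)⁻¹ ^ n) := by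
            rw [pow_succ, show (2 : ℝ) ^ n * 2 * (r * 2⁻¹ ^ n) = 2 * r * (2 ^ n * (2 : ℝ)⁻¹ ^ n) by
              ring, h2, mul_one]
        _ ≤ 2 ^ (n + 1) * (r * dist (a true) (a false)) := by gcongr
        _ ≤ _ := by gcongr; exact hlow _ _ _
    obtain ⟨i, hi⟩ : ∃ i, r ≤ ‖d i‖ := by
      by_contra! hcon
      have := norm_sub_le (d true) (d false)
      linarith [hcon true, hcon false]
    refine ⟨d i, hi, ⟨n + 1, diamondIncl n u, a i, (ha i).1, ?_⟩,
      ⟨n + 1, a i, diamondIncl n v, (ha i).2, ?_⟩⟩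
    · rw [hf]
      simp only [d]
      module
    · rw [hf]
      simp only [d, hs, pow_succ]
      module

/-! ### Ancestors in the binary tree -/

/-- The ancestor at level `k` of the node `i` of the binary tree, and `i` itself if its level is at
most `k`. The node `i` has level `Nat.log 2 i` and parent `i / 2`. -/
def ancestor (k i : ℕ) : ℕ := i / 2 ^ (Nat.log 2 i - k)

theorem ancestor_of_lt {k i : ℕ} (hi : i < 2 ^ (k + 1)) : ancestor k i = i := by
  have : Nat.log 2 i < k + 1 := Nat.log_lt_of_lt_pow' (by omega) hi
  rw [ancestor, show Nat.log 2 i - k = 0 by omega, pow_zero, Nat.div_one]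

theorem ancestor_half {k i : ℕ} (hi : 2 ^ (k + 1) ≤ i) : ancestor k (i / 2) = ancestor k i := by
  have h : k + 1 ≤ Nat.log 2 i := Nat.le_log_of_pow_le (by norm_num) hi
  rw [ancestor, ancestor, Nat.log_div_base, Nat.div_div_eq_div_mul, ← pow_succ',
    show Nat.log 2 i - 1 - k + 1 = Nat.log 2 i - k by omega]

theorem ancestor_lt (k i : ℕ) : ancestor k i < 2 ^ (k + 1) := by
  induction i using Nat.strong_induction_on with
  | _ i ih =>
    by_cases hi : i < 2 ^ (k + 1)
    · rwa [ancestor_of_lt hi]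
    · rw [← ancestor_half (not_lt.1 hi)]
      refine ih _ (Nat.div_lt_self ?_ (by norm_num))
      exact (Nat.two_pow_pos _).trans_le (not_lt.1 hi)

/-! ### A Banach space of functions of tree functions -/

mutual
/-- The levels of the binary tree at which the functions in `treeFunctions` may change. -/
def jumpLevel : ℕ → ℕ
  | 0 => 1
  | l + 1 => jumpLevel l + (l + 1) * jumpExponent (l + 1)
/-- The exponent of the norm controlling the change of the functions in `treeFunctions` at the level
`jumpLevel l`. It is large compared with the number of nodes at the preceding jump levels, and the
gap between that jump level and the preceding one is large compared with the exponent. -/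
def jumpExponent : ℕ → ℕ
  | 0 => 1
  | l + 1 => (l + 1) * 4 ^ (jumpLevel l + 1)
end

theorem jumpLevel_succ (l : ℕ) :
    jumpLevel (l + 1) = jumpLevel l + (l + 1) * jumpExponent (l + 1) := by
  rw [jumpLevel]

theorem jumpExponent_succ (l : ℕ) : jumpExponent (l + 1) = (l + 1) * 4 ^ (jumpLevel l + 1) := by
  rw [jumpExponent]

theorem jumpExponent_pos (l : ℕ) : 0 < jumpExponent l := by
  cases l with
  | zero => rw [jumpExponent]; norm_num
  | succ l => rw [jumpExponent_succ]; positivity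

theorem strictMono_jumpLevel : StrictMono jumpLevel := by
  refine strictMono_nat_of_lt_succ fun l => ?_
  rw [jumpLevel_succ]
  exact Nat.lt_add_of_pos_right (Nat.mul_pos l.succ_pos (jumpExponent_pos (l + 1)))

theorem mul_jumpExponent_le_jumpLevel (l : ℕ) : l * jumpExponent l ≤ jumpLevel l := by
  cases l with
  | zero => simp
  | succ l => rw [jumpLevel_succ]; omega

theorem monotone_jumpExponent : Monotone jumpExponent := by
  refine monotone_nat_of_le_succ fun l => ?_
  cases l with
  | zero => exact (by rw [jumpExponent] : jumpExponent 0 = 1).trans_le (jumpExponent_pos _)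
  | succ l =>
    rw [jumpExponent_succ, jumpExponent_succ]
    have := strictMono_jumpLevel.monotone l.le_succ
    gcongr
    · omega
    · norm_num

/-- The functions `G` on the nodes of the binary tree, bounded by `1` and vanishing at the root,
whose jumps `G i - G (i / 2)` are `0` except at the levels `jumpLevel l`, where they form a vector
in the unit ball of `ℓ^p` for `p = jumpExponent l`. -/
def treeFunctions : Set (ℕ → ℝ) :=
  {G | G 0 = 0 ∧ (∀ i, |G i| ≤ 1) ∧ (∀ i, Nat.log 2 i ∉ range jumpLevel → G i = G (i / 2)) ∧
    ∀ l, ∑ i ∈ Finset.Ico (2 ^ jumpLevel l) (2 ^ (jumpLevel l + 1)),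
      |G i - G (i / 2)| ^ jumpExponent l ≤ 1}

namespace treeFunctions

instance : Zero treeFunctions :=
  ⟨⟨0, rfl, by simp, by simp, fun l => by simp [(jumpExponent_pos l).ne']⟩⟩

instance : Neg treeFunctions :=
  ⟨fun G => ⟨-G.1, by simp [G.2.1], by simpa using G.2.2.1,
    fun i hi => by simp [G.2.2.2.1 i hi], fun l => by
      refine (Finset.sum_congr rfl fun i _ => ?_).trans_le (G.2.2.2.2 l)
      rw [Pi.neg_apply, Pi.neg_apply, neg_sub_neg, abs_sub_comm]⟩⟩

theorem zero_apply (i : ℕ) : (0 : treeFunctions).1 i = 0 := rfl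

theorem neg_apply (G : treeFunctions) (i : ℕ) : (-G).1 i = -G.1 i := rfl

theorem comp_ancestor_mem (k : ℕ) (G : treeFunctions) :
    (fun i => G.1 (ancestor k i)) ∈ treeFunctions := by
  refine ⟨?_, fun i => G.2.2.1 _, fun i hi => ?_, fun l => ?_⟩
  · simp only [ancestor_of_lt (Nat.two_pow_pos (k + 1)), G.2.1]
  · by_cases h : i < 2 ^ (k + 1)
    · simp only [ancestor_of_lt h, ancestor_of_lt ((Nat.div_le_self i 2).trans_lt h),
        ← G.2.2.2.1 i hi]
    · simp only [ancestor_half (not_lt.1 h)]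
  · refine (Finset.sum_le_sum fun i _ => ?_).trans (G.2.2.2.2 l)
    by_cases h : i < 2 ^ (k + 1)
    · simp only [ancestor_of_lt h, ancestor_of_lt ((Nat.div_le_self i 2).trans_lt h), le_refl]
    · simp only [ancestor_half (not_lt.1 h), sub_self, abs_zero, zero_pow (jumpExponent_pos l).ne']
      positivity

/-- The tree function which is frozen after level `k`. -/
def freeze (k : ℕ) (G : treeFunctions) : treeFunctions :=
  ⟨fun i => G.1 (ancestor k i), comp_ancestor_mem k G⟩

theorem freeze_apply (k : ℕ) (G : treeFunctions) (i : ℕ) :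
    (freeze k G).1 i = G.1 (ancestor k i) := rfl

theorem freeze_neg (k : ℕ) (G : treeFunctions) : freeze k (-G) = -freeze k G := rfl

theorem continuous_freeze (k : ℕ) : Continuous (freeze k) :=
  Continuous.subtype_mk
    (continuous_pi fun i => (continuous_apply (ancestor k i)).comp continuous_subtype_val)
    (comp_ancestor_mem k)

/-- Criterion for membership in `treeFunctions`: up to the level `jumpLevel l` the jumps are those
of a tree function, and afterwards they are controlled by those of at most
`2 ^ jumpExponent (l + 1)` tree functions. The factor `1 / 2` absorbs the number of functions. -/
theorem mem_of_jump_le {ι : Type*} {s : Finset ι} {l : ℕ} (hs : s.card ≤ 2 ^ jumpExponent (l + 1))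
    (A : treeFunctions) (g : ι → treeFunctions) {B : ℕ → ℝ} (h0 : B 0 = 0) (h1 : ∀ i, |B i| ≤ 1)
    (hA : ∀ i < 2 ^ (jumpLevel l + 1), B i - B (i / 2) = A.1 i - A.1 (i / 2))
    (hg : ∀ i, 2 ^ (jumpLevel l + 1) ≤ i →
      ∃ w ∈ s, |B i - B (i / 2)| ≤ 1 / 2 * |(g w).1 i - (g w).1 (i / 2)|) :
    B ∈ treeFunctions := by
  refine ⟨h0, h1, fun i hi => ?_, fun l' => ?_⟩
  · by_cases h : i < 2 ^ (jumpLevel l + 1)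
    · have := hA i h
      rw [A.2.2.2.1 i hi, sub_self] at this
      exact sub_eq_zero.1 this
    · obtain ⟨w, -, hw⟩ := hg i (not_lt.1 h)
      rw [(g w).2.2.2.1 i hi, sub_self, abs_zero, mul_zero] at hw
      exact sub_eq_zero.1 (abs_nonpos_iff.1 hw)
  · obtain hl | hl := le_or_gt l' l
    · refine (Finset.sum_congr rfl fun i hi => ?_).trans_le (A.2.2.2.2 l')
      rw [hA i ((Finset.mem_Ico.1 hi).2.trans_le ?_)]
      exact Nat.pow_le_pow_right (by norm_num)
        (Nat.succ_le_succ (strictMono_jumpLevel.monotone hl))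
    · set e := jumpExponent l' with he
      have hcard : (s.card : ℝ) ≤ 2 ^ e := by
        have : 2 ^ jumpExponent (l + 1) ≤ 2 ^ e :=
          Nat.pow_le_pow_right (by norm_num) (monotone_jumpExponent hl)
        exact_mod_cast hs.trans this
      calc ∑ i ∈ Finset.Ico (2 ^ jumpLevel l') (2 ^ (jumpLevel l' + 1)), |B i - B (i / 2)| ^ e
          ≤ ∑ i ∈ Finset.Ico (2 ^ jumpLevel l') (2 ^ (jumpLevel l' + 1)),
            ∑ w ∈ s, (1 / 2) ^ e * |(g w).1 i - (g w).1 (i / 2)| ^ e := by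
            refine Finset.sum_le_sum fun i hi => ?_
            obtain ⟨w, hws, hw⟩ := hg i (le_trans (Nat.pow_le_pow_right (by norm_num)
              (strictMono_jumpLevel hl)) (Finset.mem_Ico.1 hi).1)
            calc |B i - B (i / 2)| ^ e ≤ (1 / 2 * |(g w).1 i - (g w).1 (i / 2)|) ^ e := by gcongr
              _ = (1 / 2) ^ e * |(g w).1 i - (g w).1 (i / 2)| ^ e := mul_pow _ _ _
              _ ≤ _ := Finset.single_le_sum
                (f := fun w => (1 / 2 : ℝ) ^ e * |(g w).1 i - (g w).1 (i / 2)| ^ e)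
                (fun w _ => by positivity) hws
        _ = ∑ w ∈ s, (1 / 2) ^ e * ∑ i ∈ Finset.Ico (2 ^ jumpLevel l') (2 ^ (jumpLevel l' + 1)),
            |(g w).1 i - (g w).1 (i / 2)| ^ e := by
            rw [Finset.sum_comm]
            simp_rw [Finset.mul_sum]
        _ ≤ ∑ w ∈ s, (1 / 2) ^ e * 1 := by
            gcongr with w
            exact (g w).2.2.2.2 l'
        _ = s.card * (1 / 2) ^ e := by rw [Finset.sum_const, nsmul_eq_mul, mul_one]
        _ ≤ 2 ^ e * (1 / 2) ^ e := by gcongr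
        _ = 1 := by rw [← mul_pow]; norm_num

end treeFunctions

/-- The evaluation of tree functions at the node `i`. -/
noncomputable def nodeEval (i : ℕ) : treeFunctions →ᵇ ℝ :=
  BoundedContinuousFunction.ofNormedAddCommGroup (fun G => G.1 i)
    ((continuous_apply i).comp continuous_subtype_val) 1 fun G => G.2.2.1 i

theorem nodeEval_apply (i : ℕ) (G : treeFunctions) : nodeEval i G = G.1 i := rfl

theorem norm_nodeEval_le (i : ℕ) : ‖nodeEval i‖ ≤ 1 :=
  (BoundedContinuousFunction.norm_le zero_le_one).2 fun G => G.2.2.1 i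

/-- The closed linear span of the evaluations at the nodes of the binary tree, in the space of the
bounded continuous functions on `treeFunctions` (with the topology of pointwise convergence). -/
noncomputable def treeSpace : Submodule ℝ (treeFunctions →ᵇ ℝ) :=
  (Submodule.span ℝ (range nodeEval)).topologicalClosure

theorem nodeEval_mem (i : ℕ) : nodeEval i ∈ treeSpace :=
  Submodule.le_topologicalClosure _ (Submodule.subset_span (mem_range_self i))

instance : CompleteSpace treeSpace := Submodule.topologicalClosure.completeSpace _

/-- The elements of `treeSpace` are linear on `treeFunctions`, as far as this makes sense. -/
theorem apply_eq_sum_of_mem_treeSpace {a : treeFunctions →ᵇ ℝ} (ha : a ∈ treeSpace) {ι : Type*}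
    (s : Finset ι) (c : ι → ℝ) (g : ι → treeFunctions) (G : treeFunctions)
    (h : ∀ i, G.1 i = ∑ j ∈ s, c j * (g j).1 i) : a G = ∑ j ∈ s, c j * a (g j) := by
  let Λ : (treeFunctions →ᵇ ℝ) →L[ℝ] ℝ :=
    BoundedContinuousFunction.evalCLM ℝ G - ∑ j ∈ s, c j • BoundedContinuousFunction.evalCLM ℝ (g j)
  have hΛ (b : treeFunctions →ᵇ ℝ) : Λ b = b G - ∑ j ∈ s, c j * b (g j) := by
    simp [Λ]
  have hle : treeSpace ≤ LinearMap.ker Λ.toLinearMap := by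
    refine Submodule.topologicalClosure_minimal _ (Submodule.span_le.2 ?_) Λ.isClosed_ker
    rintro _ ⟨i, rfl⟩
    change Λ (nodeEval i) = 0
    rw [hΛ]
    simp only [nodeEval_apply, h, sub_self]
  have := hle ha
  change Λ a = 0 at this
  rw [hΛ] at this
  exact sub_eq_zero.1 this

theorem apply_zero_of_mem_treeSpace {a : treeFunctions →ᵇ ℝ} (ha : a ∈ treeSpace) : a 0 = 0 := by
  simpa using apply_eq_sum_of_mem_treeSpace ha (∅ : Finset ℕ) 0 0 0 (by simp [treeFunctions.zero_apply])

theorem apply_neg_of_mem_treeSpace {a : treeFunctions →ᵇ ℝ} (ha : a ∈ treeSpace)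
    (G : treeFunctions) : a (-G) = -a G := by
  simpa using apply_eq_sum_of_mem_treeSpace ha {0} (fun _ : ℕ => -1) (fun _ => G) (-G)
    (by simp [treeFunctions.neg_apply])

/-- The projection `a ↦ (G ↦ a (freeze k G))`, which maps the evaluation at a node to the evaluation
at its ancestor at level `k`. -/
noncomputable def levelProj (k : ℕ) (a : treeFunctions →ᵇ ℝ) : treeFunctions →ᵇ ℝ :=
  a.compContinuous ⟨treeFunctions.freeze k, treeFunctions.continuous_freeze k⟩

theorem levelProj_apply (k : ℕ) (a : treeFunctions →ᵇ ℝ) (G : treeFunctions) :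
    levelProj k a G = a (treeFunctions.freeze k G) := rfl

theorem levelProj_add (k : ℕ) (a b : treeFunctions →ᵇ ℝ) :
    levelProj k (a + b) = levelProj k a + levelProj k b := rfl

theorem levelProj_sub (k : ℕ) (a b : treeFunctions →ᵇ ℝ) :
    levelProj k (a - b) = levelProj k a - levelProj k b := rfl

theorem norm_levelProj_le (k : ℕ) (a : treeFunctions →ᵇ ℝ) : ‖levelProj k a‖ ≤ ‖a‖ :=
  (BoundedContinuousFunction.norm_le (norm_nonneg a)).2 fun _ => a.norm_coe_le_norm _

/-- The projections `levelProj k` converge strongly to the identity on `treeSpace`. -/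
theorem eventually_norm_sub_levelProj_le {a : treeFunctions →ᵇ ℝ} (ha : a ∈ treeSpace) {η : ℝ}
    (hη : 0 < η) : ∀ᶠ k in atTop, ‖a - levelProj k a‖ ≤ η := by
  have hspan : ∀ b ∈ Submodule.span ℝ (range nodeEval), ∀ᶠ k in atTop, levelProj k b = b := by
    intro b hb
    induction hb using Submodule.span_induction with
    | mem b hb =>
      obtain ⟨i, rfl⟩ := hb
      filter_upwards [eventually_ge_atTop i] with k hk
      ext G
      rw [levelProj_apply, nodeEval_apply, nodeEval_apply, treeFunctions.freeze_apply,
        ancestor_of_lt (Nat.lt_two_pow_self.trans (Nat.pow_lt_pow_right (by norm_num) (by omega)))]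
    | zero => exact Eventually.of_forall fun k => rfl
    | add b c _ _ hb hc =>
      filter_upwards [hb, hc] with k h1 h2
      rw [levelProj_add, h1, h2]
    | smul r b _ hb =>
      filter_upwards [hb] with k h1
      conv_rhs => rw [← h1]
      rfl
  obtain ⟨b, hb, hab⟩ := Metric.mem_closure_iff.1 ha (η / 2) (by positivity)
  filter_upwards [hspan b hb] with k hk
  rw [dist_eq_norm] at hab
  have h1 : a - levelProj k a = (a - b) - levelProj k (a - b) := by
    rw [levelProj_sub, hk]
    abel
  rw [h1]
  have := norm_sub_le (a - b) (levelProj k (a - b))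
  have := norm_levelProj_le k (a - b)
  linarith

theorem exists_norm_sub_le_apply {b : treeFunctions →ᵇ ℝ} (hb : ∀ G, b (-G) = -b G) {η : ℝ}
    (hη : 0 < η) : ∃ G, ‖b‖ - η ≤ b G := by
  by_contra! hcon
  have : ‖b‖ ≤ ‖b‖ - η := by
    refine (BoundedContinuousFunction.norm_le_of_nonempty).2 fun G => ?_
    rw [Real.norm_eq_abs, abs_le']
    exact ⟨(hcon G).le, by rw [← hb]; exact (hcon _).le⟩
  linarith

theorem Finset.exists_abs_sup'_sub_sup'_le {ι : Type*} {s : Finset ι} (hs : s.Nonempty)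
    (a b : ι → ℝ) : ∃ w ∈ s, |s.sup' hs a - s.sup' hs b| ≤ |a w - b w| := by
  obtain ⟨v, hv, hva⟩ := s.exists_mem_eq_sup' hs a
  obtain ⟨w, hw, hwb⟩ := s.exists_mem_eq_sup' hs b
  have h1 := s.le_sup' b hv
  have h2 := s.le_sup' a hw
  obtain h | h := le_total (s.sup' hs a) (s.sup' hs b)
  · refine ⟨w, hw, ?_⟩
    rw [abs_of_nonpos (by linarith)]
    exact le_trans (by linarith) (neg_le_abs _)
  · refine ⟨v, hv, ?_⟩
    rw [abs_of_nonneg (by linarith)]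
    exact le_trans (by linarith) (le_abs_self _)

theorem Finset.exists_abs_inf'_sub_inf'_le {ι : Type*} {s : Finset ι} (hs : s.Nonempty)
    (a b : ι → ℝ) : ∃ w ∈ s, |s.inf' hs a - s.inf' hs b| ≤ |a w - b w| := by
  obtain ⟨v, hv, hva⟩ := s.exists_mem_eq_inf' hs a
  obtain ⟨w, hw, hwb⟩ := s.exists_mem_eq_inf' hs b
  have h1 := s.inf'_le b hv
  have h2 := s.inf'_le a hw
  obtain h | h := le_total (s.inf' hs a) (s.inf' hs b)
  · refine ⟨v, hv, ?_⟩
    rw [abs_of_nonpos (by linarith)]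
    exact le_trans (by linarith) (neg_le_abs _)
  · refine ⟨w, hw, ?_⟩
    rw [abs_of_nonneg (by linarith)]
    exact le_trans (by linarith) (le_abs_self _)

/-- The norm of `treeSpace` resembles that of an `ℓ¹`-sum in the following sense: if an element `x`
which lives essentially on the levels up to `jumpLevel l` is the average of at most
`2 ^ jumpExponent (l + 1)` elements `y w`, then the average of the norms of the `y w` exceeds `‖x‖`
by a fixed proportion of the average norm of the parts of the `y w` beyond that level. -/
theorem card_mul_norm_add_le_sum_norm {ι : Type*} {s : Finset ι} (hs : s.Nonempty) {l : ℕ}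
    (hcard : s.card ≤ 2 ^ jumpExponent (l + 1)) {y : ι → treeFunctions →ᵇ ℝ}
    (hy : ∀ w, y w ∈ treeSpace) {x : treeFunctions →ᵇ ℝ} (hx : x ∈ treeSpace)
    (hxy : ∑ w ∈ s, y w = (s.card : ℝ) • x) {η : ℝ} (hη : 0 < η)
    (hxη : ‖x - levelProj (jumpLevel l) x‖ ≤ η) :
    s.card * ‖x‖ + 1 / 4 * ∑ w ∈ s, ‖y w - levelProj (jumpLevel l) (y w)‖
      ≤ ∑ w ∈ s, ‖y w‖ + s.card * (4 * η) := by
  set k := jumpLevel l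
  obtain ⟨f, hf⟩ := exists_norm_sub_le_apply (apply_neg_of_mem_treeSpace hx) hη
  have hg (w : ι) : ∃ G, ‖y w - levelProj k (y w)‖ - η ≤ (y w - levelProj k (y w)) G := by
    refine exists_norm_sub_le_apply (fun G => ?_) hη
    simp only [BoundedContinuousFunction.coe_sub, Pi.sub_apply, levelProj_apply,
      treeFunctions.freeze_neg, apply_neg_of_mem_treeSpace (hy w)]
    ring
  choose g hg using hg
  set A := treeFunctions.freeze k f with hA
  have hAhalf {i : ℕ} (hi : 2 ^ (k + 1) ≤ i) : A.1 (i / 2) = A.1 i := by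
    simp only [hA, treeFunctions.freeze_apply, ancestor_half hi]
  -- half of the part of `g w` beyond the level `k`
  let T (w : ι) (i : ℕ) : ℝ := ((g w).1 i - (g w).1 (ancestor k i)) / 2
  have hT1 (w : ι) (i : ℕ) : |T w i| ≤ 1 := by
    have h1 := abs_le.1 ((g w).2.2.1 i)
    have h2 := abs_le.1 ((g w).2.2.1 (ancestor k i))
    rw [abs_le]
    constructor <;> simp only [T] <;> linarith
  have hT0 (w : ι) {i : ℕ} (hi : i < 2 ^ (k + 1)) : T w i = 0 := by
    simp only [T, ancestor_of_lt hi, sub_self, zero_div]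
  have hTjump (w : ι) {i : ℕ} (hi : 2 ^ (k + 1) ≤ i) :
      T w i - T w (i / 2) = ((g w).1 i - (g w).1 (i / 2)) / 2 := by
    simp only [T, ancestor_half hi]
    ring
  -- The correction which does not depend on `w`. Its choice makes `T w - U` of the sign opposite to
  -- that of `A`, so that `A` can be perturbed by it without leaving `treeFunctions`.
  let U (i : ℕ) : ℝ :=
    if 0 ≤ A.1 i then s.sup' hs (fun w => T w i) else s.inf' hs (fun w => T w i)
  have hU0 {i : ℕ} (hi : i < 2 ^ (k + 1)) : U i = 0 := by
    simp only [U, hT0 _ hi, Finset.sup'_const, Finset.inf'_const, ite_self]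
  have hUjump {i : ℕ} (hi : 2 ^ (k + 1) ≤ i) :
      ∃ w ∈ s, |U i - U (i / 2)| ≤ |(g w).1 i - (g w).1 (i / 2)| / 2 := by
    simp only [U, hAhalf hi]
    split_ifs
    · obtain ⟨w, hw, h⟩ := Finset.exists_abs_sup'_sub_sup'_le hs (fun w => T w i)
        (fun w => T w (i / 2))
      refine ⟨w, hw, h.trans_eq ?_⟩
      rw [hTjump w hi, abs_div, abs_two]
    · obtain ⟨w, hw, h⟩ := Finset.exists_abs_inf'_sub_inf'_le hs (fun w => T w i)
        (fun w => T w (i / 2))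
      refine ⟨w, hw, h.trans_eq ?_⟩
      rw [hTjump w hi, abs_div, abs_two]
  have hU1 (i : ℕ) : |U i| ≤ 1 := by
    simp only [U]
    split_ifs
    · obtain ⟨w, -, h⟩ := s.exists_mem_eq_sup' hs (fun w => T w i)
      rw [h]
      exact hT1 w i
    · obtain ⟨w, -, h⟩ := s.exists_mem_eq_inf' hs (fun w => T w i)
      rw [h]
      exact hT1 w i
  have hUmem : (fun i => U i / 2) ∈ treeFunctions := by
    refine treeFunctions.mem_of_jump_le hcard 0 g ?_ (fun i => ?_) (fun i hi => ?_) fun i hi => ?_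
    · rw [hU0 (Nat.two_pow_pos _), zero_div]
    · rw [abs_div, abs_two]
      linarith [hU1 i]
    · simp only [treeFunctions.zero_apply, hU0 hi, hU0 ((Nat.div_le_self i 2).trans_lt hi)]
      norm_num
    · obtain ⟨w, hw, h⟩ := hUjump hi
      refine ⟨w, hw, ?_⟩
      rw [← sub_div, abs_div, abs_two]
      linarith [abs_nonneg ((g w).1 i - (g w).1 (i / 2))]
  have hmem (w : ι) (hw : w ∈ s) : (fun i => A.1 i + (T w i - U i) / 2) ∈ treeFunctions := by
    refine treeFunctions.mem_of_jump_le hcard A g ?_ (fun i => ?_) (fun i hi => ?_) fun i hi => ?_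
    · rw [hU0 (Nat.two_pow_pos _), hT0 w (Nat.two_pow_pos _), A.2.1]
      norm_num
    · have h1 := abs_le.1 (A.2.2.1 i)
      have h2 := abs_le.1 (hT1 w i)
      have h3 := abs_le.1 (hU1 i)
      rw [abs_le]
      by_cases h : 0 ≤ A.1 i
      · have h4 : T w i ≤ U i := by
          simp only [U, if_pos h]
          exact s.le_sup' (fun w => T w i) hw
        constructor <;> linarith
      · have h4 : U i ≤ T w i := by
          simp only [U, if_neg h]
          exact s.inf'_le (fun w => T w i) hw
        constructor <;> linarith
    · simp only [hU0 hi, hU0 ((Nat.div_le_self i 2).trans_lt hi), hT0 w hi,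
        hT0 w ((Nat.div_le_self i 2).trans_lt hi)]
      ring
    · obtain ⟨v, hv, h⟩ := hUjump hi
      have e : A.1 i + (T w i - U i) / 2 - (A.1 (i / 2) + (T w (i / 2) - U (i / 2)) / 2)
          = ((g w).1 i - (g w).1 (i / 2)) / 4 - (U i - U (i / 2)) / 2 := by
        rw [hAhalf hi]
        linear_combination (1 / 2 : ℝ) * hTjump w hi
      have h' : |A.1 i + (T w i - U i) / 2 - (A.1 (i / 2) + (T w (i / 2) - U (i / 2)) / 2)|
          ≤ |(g w).1 i - (g w).1 (i / 2)| / 4 + |U i - U (i / 2)| / 2 := by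
        rw [e]
        refine (abs_sub _ _).trans_eq ?_
        rw [abs_div, abs_div, abs_two, abs_of_pos (by norm_num : (0 : ℝ) < 4)]
      obtain h2 | h2 := le_total |(g w).1 i - (g w).1 (i / 2)| |(g v).1 i - (g v).1 (i / 2)|
      · exact ⟨v, hv, by linarith⟩
      · exact ⟨w, hw, by linarith⟩
  set V : treeFunctions := ⟨fun i => U i / 2, hUmem⟩ with hV
  have hVfreeze : treeFunctions.freeze k V = 0 := by
    refine Subtype.ext (funext fun i => ?_)
    simp only [treeFunctions.freeze_apply, hV, hU0 (ancestor_lt k i), zero_div,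
      treeFunctions.zero_apply]
  have hxV : x V ≤ η := by
    have h1 := (x - levelProj k x).norm_coe_le_norm V
    rw [BoundedContinuousFunction.coe_sub, Pi.sub_apply, levelProj_apply, hVfreeze,
      apply_zero_of_mem_treeSpace hx, sub_zero] at h1
    exact (le_abs_self _).trans (h1.trans hxη)
  have hxA : ‖x‖ - 2 * η ≤ x A := by
    have h1 := (x - levelProj k x).norm_coe_le_norm f
    rw [BoundedContinuousFunction.coe_sub, Pi.sub_apply, levelProj_apply] at h1
    have h2 := (le_abs_self _).trans (h1.trans hxη)
    linarith
  have hyw (w : ι) (hw : w ∈ s) :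
      y w A + 1 / 4 * (‖y w - levelProj k (y w)‖ - η) - y w V ≤ ‖y w‖ := by
    have h1 := (le_abs_self _).trans ((y w).norm_coe_le_norm ⟨_, hmem w hw⟩)
    have h2 := apply_eq_sum_of_mem_treeSpace (hy w) (Finset.univ : Finset (Fin 4))
      ![1, 1 / 4, -1 / 4, -1] ![A, g w, treeFunctions.freeze k (g w), V] ⟨_, hmem w hw⟩
      (fun i => by
        simp [Fin.sum_univ_four, hV, T, treeFunctions.freeze_apply]
        ring)
    have h3 := hg w
    rw [BoundedContinuousFunction.coe_sub, Pi.sub_apply, levelProj_apply] at h3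
    simp [Fin.sum_univ_four] at h2
    linarith
  have hsum := Finset.sum_le_sum hyw
  have hsumA (G : treeFunctions) : ∑ w ∈ s, y w G = s.card * x G := by
    have := congrArg (fun b : treeFunctions →ᵇ ℝ => b G) hxy
    simpa [BoundedContinuousFunction.coe_sum] using this
  rw [Finset.sum_sub_distrib, Finset.sum_add_distrib, hsumA, hsumA, ← Finset.mul_sum,
    Finset.sum_sub_distrib, Finset.sum_const, nsmul_eq_mul] at hsum
  have hc : (0 : ℝ) ≤ s.card := Nat.cast_nonneg _
  nlinarith [mul_le_mul_of_nonneg_left hxA hc, mul_le_mul_of_nonneg_left hxV hc,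
    mul_nonneg hc hη.le]

/-! ### Coordinates -/

/-- The indicator function of the set of the descendants of the node `u`, `u` included. -/
noncomputable def descendantIndicator (u i : ℕ) : ℝ := if ancestor (Nat.log 2 u) i = u then 1 else 0

theorem descendantIndicator_zero_right {u : ℕ} (hu : 1 ≤ u) : descendantIndicator u 0 = 0 := by
  rw [descendantIndicator, ancestor_of_lt (Nat.two_pow_pos _), if_neg (by omega)]

theorem descendantIndicator_eq_add_half {u : ℕ} (hu : 1 ≤ u) (i : ℕ) :
    descendantIndicator u i = (if u = i then 1 else 0) + descendantIndicator u (i / 2) := by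
  have h1 : 2 ^ Nat.log 2 u ≤ u := Nat.pow_log_le_self 2 (by omega)
  have h2 : u < 2 ^ (Nat.log 2 u + 1) := Nat.lt_pow_succ_log_self (by norm_num) u
  rw [descendantIndicator, descendantIndicator]
  by_cases h : i < 2 ^ (Nat.log 2 u + 1)
  · have h3 : i / 2 < 2 ^ Nat.log 2 u := by rw [pow_succ] at h; omega
    rw [ancestor_of_lt h, ancestor_of_lt (by omega), if_neg (by omega : i / 2 ≠ u), add_zero]
    simp only [eq_comm]
  · rw [ancestor_half (not_lt.1 h), if_neg (by omega : u ≠ i), zero_add]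

theorem descendantIndicator_mem {u : ℕ} (hu : 1 ≤ u) (hlog : Nat.log 2 u ∈ range jumpLevel) :
    descendantIndicator u ∈ treeFunctions := by
  have hjump (i : ℕ) : descendantIndicator u i - descendantIndicator u (i / 2)
      = if u = i then 1 else 0 := by
    rw [descendantIndicator_eq_add_half hu i, add_sub_cancel_right]
  refine ⟨descendantIndicator_zero_right hu, fun i => ?_, fun i hi => ?_, fun l => ?_⟩
  · rw [descendantIndicator]
    split_ifs <;> simp
  · have := hjump i
    rw [if_neg (by rintro rfl; exact hi hlog)] at this
    exact sub_eq_zero.1 this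
  · simp only [hjump]
    calc ∑ i ∈ Finset.Ico (2 ^ jumpLevel l) (2 ^ (jumpLevel l + 1)),
          |if u = i then (1 : ℝ) else 0| ^ jumpExponent l
        = ∑ i ∈ Finset.Ico (2 ^ jumpLevel l) (2 ^ (jumpLevel l + 1)), if u = i then 1 else 0 := by
          refine Finset.sum_congr rfl fun i _ => ?_
          split_ifs <;> simp [(jumpExponent_pos l).ne']
      _ ≤ 1 := by
          rw [Finset.sum_ite_eq]
          split_ifs <;> norm_num

open Classical in
/-- The indicator function of the set of the descendants of `u`, if this is a tree function, and
`0` otherwise. Evaluation at it is the coordinate functional belonging to the node `u`. -/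
noncomputable def coordFunction (u : ℕ) : treeFunctions :=
  if h : descendantIndicator u ∈ treeFunctions then ⟨descendantIndicator u, h⟩ else 0

theorem coordFunction_apply {u : ℕ} (hu : 1 ≤ u) (hlog : Nat.log 2 u ∈ range jumpLevel) (i : ℕ) :
    (coordFunction u).1 i = descendantIndicator u i := by
  rw [coordFunction, dif_pos (descendantIndicator_mem hu hlog)]

/-- A frozen tree function is the sum of its jumps. -/
theorem treeFunctions.freeze_eq_sum (k : ℕ) (G : treeFunctions) (i : ℕ) :
    (freeze k G).1 i = ∑ u ∈ Finset.Ico 1 (2 ^ (k + 1)),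
      (G.1 u - G.1 (u / 2)) * (coordFunction u).1 i := by
  have hsum : ∑ u ∈ Finset.Ico 1 (2 ^ (k + 1)), (G.1 u - G.1 (u / 2)) * (coordFunction u).1 i
      = ∑ u ∈ Finset.Ico 1 (2 ^ (k + 1)), (G.1 u - G.1 (u / 2)) * descendantIndicator u i := by
    refine Finset.sum_congr rfl fun u hu => ?_
    by_cases hlog : Nat.log 2 u ∈ range jumpLevel
    · rw [coordFunction_apply (Finset.mem_Ico.1 hu).1 hlog]
    · rw [← G.2.2.2.1 u hlog, sub_self, zero_mul, zero_mul]
  rw [hsum, freeze_apply]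
  clear hsum
  induction i using Nat.strong_induction_on with
  | _ i ih =>
    obtain rfl | hi := Nat.eq_zero_or_pos i
    · rw [ancestor_of_lt (Nat.two_pow_pos _), G.2.1, Finset.sum_eq_zero fun u hu => by
        rw [descendantIndicator_zero_right (Finset.mem_Ico.1 hu).1, mul_zero]]
    · have hstep : ∑ u ∈ Finset.Ico 1 (2 ^ (k + 1)), (G.1 u - G.1 (u / 2)) * descendantIndicator u i
          = (if i < 2 ^ (k + 1) then G.1 i - G.1 (i / 2) else 0) + G.1 (ancestor k (i / 2)) := by
        rw [ih (i / 2) (by omega), Finset.sum_congr rfl fun u hu => by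
          rw [descendantIndicator_eq_add_half (Finset.mem_Ico.1 hu).1 i, mul_add, mul_ite, mul_one,
            mul_zero], Finset.sum_add_distrib, Finset.sum_ite_eq' _ i]
        simp only [Finset.mem_Ico, Nat.succ_le_of_lt hi, true_and]
      rw [hstep]
      by_cases h : i < 2 ^ (k + 1)
      · rw [if_pos h, ancestor_of_lt h, ancestor_of_lt (by omega), sub_add_cancel]
      · rw [if_neg h, ancestor_half (not_lt.1 h), zero_add]

theorem norm_levelProj_le_sum {a : treeFunctions →ᵇ ℝ} (ha : a ∈ treeSpace) (k : ℕ) :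
    ‖levelProj k a‖ ≤ 2 * ∑ u ∈ Finset.Ico 1 (2 ^ (k + 1)), |a (coordFunction u)| := by
  refine (BoundedContinuousFunction.norm_le (by positivity)).2 fun G => ?_
  rw [levelProj_apply, apply_eq_sum_of_mem_treeSpace ha _ _ _ _ (treeFunctions.freeze_eq_sum k G), Finset.mul_sum]
  refine norm_sum_le_of_le _ fun u _ => ?_
  rw [norm_mul, Real.norm_eq_abs, Real.norm_eq_abs]
  gcongr
  have := abs_sub (G.1 u) (G.1 (u / 2))
  linarith [G.2.2.1 u, G.2.2.1 (u / 2)]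

/-! ### Absence of bounded trees -/

theorem sum_descendants_eq {M : Type*} [AddCommGroup M] [Module ℝ M] {x : ℕ → M}
    (hx : ∀ i, 1 ≤ i → x i = (1 / 2 : ℝ) • (x (2 * i) + x (2 * i + 1))) {m : ℕ} (hm : 1 ≤ m)
    (h : ℕ) : ∑ j ∈ Finset.range (2 ^ h), x (2 ^ h * m + j) = (2 ^ h : ℝ) • x m := by
  induction h with
  | zero => simp
  | succ h ih =>
    rw [pow_succ' 2 h, Finset.sum_range_two_mul, pow_succ' (2 : ℝ) h, mul_smul, ← ih,
      Finset.smul_sum]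
    refine Finset.sum_congr rfl fun j _ => ?_
    have h1 : 1 ≤ 2 ^ h * m + j := le_add_right (Nat.mul_pos (Nat.two_pow_pos h) hm)
    rw [show 2 * 2 ^ h * m + 2 * j = 2 * (2 ^ h * m + j) by ring,
      show 2 * 2 ^ h * m + (2 * j + 1) = 2 * (2 ^ h * m + j) + 1 by ring, hx _ h1, smul_smul]
    norm_num

/-- Near a node of almost maximal norm, a bounded dyadic martingale in `treeSpace` stays for
`jumpExponent (l + 1)` steps essentially within the levels up to `jumpLevel l`, if the node itself
does so. -/
theorem sum_norm_sub_levelProj_le {x : ℕ → treeFunctions →ᵇ ℝ} (hmem : ∀ i, x i ∈ treeSpace)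
    (hx : ∀ i, 1 ≤ i → x i = (1 / 2 : ℝ) • (x (2 * i) + x (2 * i + 1))) {K η : ℝ} (hη : 0 < η)
    (hK : ∀ i, 1 ≤ i → ‖x i‖ ≤ K) {m l h : ℕ} (hm : 1 ≤ m) (hmK : K - η ≤ ‖x m‖)
    (hml : ‖x m - levelProj (jumpLevel l) (x m)‖ ≤ η) (hh : h ≤ jumpExponent (l + 1)) :
    ∑ j ∈ Finset.range (2 ^ h), ‖x (2 ^ h * m + j) - levelProj (jumpLevel l) (x (2 ^ h * m + j))‖
      ≤ 2 ^ h * (20 * η) := by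
  have h2 : (0 : ℝ) < 2 ^ h := by positivity
  have hcard : ((Finset.range (2 ^ h)).card : ℝ) = 2 ^ h := by simp
  have := card_mul_norm_add_le_sum_norm (s := Finset.range (2 ^ h)) (l := l)
    (y := fun j => x (2 ^ h * m + j)) (by simp)
    (by rw [Finset.card_range]; exact Nat.pow_le_pow_right (by norm_num) hh) (fun j => hmem _)
    (hmem m) (by rw [hcard, sum_descendants_eq hx hm]) hη hml
  rw [hcard] at this
  have hsum : ∑ j ∈ Finset.range (2 ^ h), ‖x (2 ^ h * m + j)‖ ≤ 2 ^ h * K := by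
    refine (Finset.sum_le_card_nsmul _ _ K fun j _ => hK _ ?_).trans_eq ?_
    · exact le_add_right (Nat.mul_pos (Nat.two_pow_pos h) hm)
    · rw [nsmul_eq_mul, hcard]
  nlinarith [mul_le_mul_of_nonneg_left hmK h2.le]

theorem not_containsBoundedDeltaTree_treeSpace {δ : ℝ} (hδ : 0 < δ) :
    ¬ ContainsBoundedDeltaTree treeSpace δ := by
  rintro ⟨x', hx', M, hM⟩
  let x (i : ℕ) : treeFunctions →ᵇ ℝ := (x' i).1
  have hmem (i : ℕ) : x i ∈ treeSpace := (x' i).2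
  have hx (i : ℕ) (hi : 1 ≤ i) : x i = (1 / 2 : ℝ) • (x (2 * i) + x (2 * i + 1)) :=
    congrArg Subtype.val (hx' i hi).1
  have hδx (i : ℕ) (hi : 1 ≤ i) : δ ≤ ‖x (2 * i) - x i‖ :=
    (hx' i hi).2.2.trans_eq (hx' i hi).2.1.symm
  -- a node `m` of almost maximal norm
  obtain ⟨K, hK⟩ : ∃ K, IsLUB ((fun i => ‖x i‖) '' Ici 1) K :=
    ⟨_, isLUB_csSup ⟨_, 1, self_mem_Ici, rfl⟩ ⟨M, by rintro _ ⟨i, hi, rfl⟩; exact hM i hi⟩⟩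
  have hxK (i : ℕ) (hi : 1 ≤ i) : ‖x i‖ ≤ K := hK.1 ⟨i, hi, rfl⟩
  set η := δ / 120 with hηdef
  have hη : 0 < η := by positivity
  obtain ⟨_, ⟨m, hm, rfl⟩, hmK, -⟩ := hK.exists_between (sub_lt_self K hη)
  rw [mem_Ici] at hm
  -- a jump level `k` beyond which `x m` has almost nothing, and which is so large that
  -- the levels up to `k` do not leave room for a tree of height `jumpExponent (l + 1)`
  obtain ⟨l, hml, hl⟩ : ∃ l, ‖x m - levelProj (jumpLevel l) (x m)‖ ≤ η ∧
      16 * K ^ 2 / δ ^ 2 < l + 1 := by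
    obtain ⟨l₀, hl₀⟩ := exists_nat_gt (16 * K ^ 2 / δ ^ 2)
    have h1 := strictMono_jumpLevel.tendsto_atTop.eventually
      (eventually_norm_sub_levelProj_le (hmem m) hη)
    obtain ⟨l, hl, hl'⟩ := (h1.and (eventually_ge_atTop l₀)).exists
    refine ⟨l, hl, hl₀.trans_le ?_⟩
    have : (l₀ : ℝ) ≤ l := by exact_mod_cast hl'
    linarith
  set k := jumpLevel l with hk
  set N : ℝ := 2 ^ (k + 1) with hN
  have hN0 : 0 < N := by positivity
  set U := Finset.Ico 1 (2 ^ (k + 1)) with hU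
  have hUcard : (U.card : ℝ) ≤ N := by
    rw [hU, Nat.card_Ico, hN]
    exact_mod_cast Nat.sub_le _ _
  have hpos (h j : ℕ) : 1 ≤ 2 ^ h * m + j := le_add_right (Nat.mul_pos (Nat.two_pow_pos h) hm)
  -- the coordinates of the increments at the descendants of `m` are large in the mean
  have hinc (h : ℕ) (hh : h < jumpExponent (l + 1)) :
      (2 : ℝ) ^ h * (δ ^ 2 / (16 * N)) ≤ ∑ j ∈ Finset.range (2 ^ h), ∑ u ∈ U,
        ((x (2 * (2 ^ h * m + j)) - x (2 ^ h * m + j)) (coordFunction u)) ^ 2 := by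
    have h2 : (0 : ℝ) < 2 ^ h := by positivity
    set d : ℕ → treeFunctions →ᵇ ℝ := fun j => x (2 * (2 ^ h * m + j)) - x (2 ^ h * m + j) with hd
    let z (i : ℕ) : ℝ := ‖x i - levelProj k (x i)‖
    have hz1 : ∑ j ∈ Finset.range (2 ^ h), z (2 ^ h * m + j) ≤ 2 ^ h * (20 * η) :=
      sum_norm_sub_levelProj_le hmem hx hη hxK hm hmK.le hml hh.le
    have hz2 : ∑ j ∈ Finset.range (2 ^ h), z (2 * (2 ^ h * m + j)) ≤ 2 ^ h * (40 * η) := by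
      have h3 : ∑ j ∈ Finset.range (2 ^ (h + 1)), z (2 ^ (h + 1) * m + j)
          ≤ 2 ^ (h + 1) * (20 * η) :=
        sum_norm_sub_levelProj_le hmem hx hη hxK hm hmK.le hml hh
      rw [pow_succ' 2 h, Finset.sum_range_two_mul, pow_succ'] at h3
      refine (Finset.sum_le_sum fun j _ => ?_).trans (h3.trans_eq (by ring))
      rw [show 2 * 2 ^ h * m + 2 * j = 2 * (2 ^ h * m + j) by ring]
      exact le_add_of_nonneg_right (norm_nonneg _)
    have hdj (j : ℕ) : δ ≤ 2 * ∑ u ∈ U, |d j (coordFunction u)|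
        + (z (2 * (2 ^ h * m + j)) + z (2 ^ h * m + j)) := by
      have h3 := norm_levelProj_le_sum (sub_mem (hmem (2 * (2 ^ h * m + j))) (hmem (2 ^ h * m + j))) k
      have e : d j = levelProj k (d j) + ((x (2 * (2 ^ h * m + j))
          - levelProj k (x (2 * (2 ^ h * m + j))))
          - (x (2 ^ h * m + j) - levelProj k (x (2 ^ h * m + j)))) := by
        simp only [hd, levelProj_sub]
        abel
      calc δ ≤ ‖d j‖ := hδx _ (hpos h j)
        _ ≤ ‖levelProj k (d j)‖ + (z (2 * (2 ^ h * m + j)) + z (2 ^ h * m + j)) := by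
          conv_lhs => rw [e]
          exact (norm_add_le _ _).trans (add_le_add_right (norm_sub_le _ _) _)
        _ ≤ _ := by gcongr
    have hsum := Finset.sum_le_sum fun j (_ : j ∈ Finset.range (2 ^ h)) => hdj j
    rw [Finset.sum_add_distrib, Finset.sum_add_distrib, ← Finset.mul_sum, Finset.sum_const,
      Finset.card_range, nsmul_eq_mul] at hsum
    push_cast at hsum
    have hlow : (2 : ℝ) ^ h * (δ / 4) ≤
        ∑ j ∈ Finset.range (2 ^ h), ∑ u ∈ U, |d j (coordFunction u)| := by
      rw [hηdef] at hz1 hz2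
      linarith
    have hcs := sq_sum_le_card_mul_sum_sq (s := Finset.range (2 ^ h) ×ˢ U)
      (f := fun p => |d p.1 (coordFunction p.2)|)
    rw [Finset.sum_product, Finset.sum_product, Finset.card_product, Finset.card_range] at hcs
    simp only [sq_abs] at hcs
    push_cast at hcs
    set Q := ∑ j ∈ Finset.range (2 ^ h), ∑ u ∈ U, (d j (coordFunction u)) ^ 2 with hQ
    have hQ0 : 0 ≤ Q := by positivity
    have h4 : ((2 : ℝ) ^ h * (δ / 4)) ^ 2 ≤ 2 ^ h * N * Q := by
      refine le_trans (by gcongr) (hcs.trans ?_)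
      gcongr
    have h5 : (2 : ℝ) ^ h * (δ ^ 2 / 16) ≤ N * Q := by
      refine le_of_mul_le_mul_left ?_ h2
      linarith
    rw [← div_div, mul_div_assoc', div_le_iff₀ hN0]
    linarith
  -- the sum of the squares of the coordinates therefore grows too fast
  have hgrow (h : ℕ) (hh : h ≤ jumpExponent (l + 1)) :
      (2 : ℝ) ^ h * (h * (δ ^ 2 / (16 * N))) ≤ ∑ j ∈ Finset.range (2 ^ h), ∑ u ∈ U,
        (x (2 ^ h * m + j) (coordFunction u)) ^ 2 := by
    induction h with
    | zero =>
      rw [Nat.cast_zero, zero_mul, mul_zero]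
      positivity
    | succ h ih =>
      have h1 := ih (by omega)
      have h2 := hinc h (by omega)
      have e : ∑ j ∈ Finset.range (2 ^ (h + 1)), ∑ u ∈ U,
          (x (2 ^ (h + 1) * m + j) (coordFunction u)) ^ 2
          = 2 * (∑ j ∈ Finset.range (2 ^ h), ∑ u ∈ U, (x (2 ^ h * m + j) (coordFunction u)) ^ 2)
            + 2 * ∑ j ∈ Finset.range (2 ^ h), ∑ u ∈ U,
              ((x (2 * (2 ^ h * m + j)) - x (2 ^ h * m + j)) (coordFunction u)) ^ 2 := by
        rw [pow_succ' 2 h, Finset.sum_range_two_mul, Finset.mul_sum, Finset.mul_sum,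
          ← Finset.sum_add_distrib]
        refine Finset.sum_congr rfl fun j _ => ?_
        rw [Finset.mul_sum, Finset.mul_sum, ← Finset.sum_add_distrib, ← Finset.sum_add_distrib]
        refine Finset.sum_congr rfl fun u _ => ?_
        rw [show 2 * 2 ^ h * m + 2 * j = 2 * (2 ^ h * m + j) by ring,
          show 2 * 2 ^ h * m + (2 * j + 1) = 2 * (2 ^ h * m + j) + 1 by ring]
        have h3 := congrArg (fun b : treeFunctions →ᵇ ℝ => b (coordFunction u)) (hx _ (hpos h j))
        simp only [BoundedContinuousFunction.coe_smul, BoundedContinuousFunction.coe_add,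
          Pi.add_apply, smul_eq_mul] at h3
        rw [BoundedContinuousFunction.coe_sub, Pi.sub_apply]
        have h4 : x (2 * (2 ^ h * m + j) + 1) (coordFunction u)
            = 2 * x (2 ^ h * m + j) (coordFunction u)
              - x (2 * (2 ^ h * m + j)) (coordFunction u) := by linarith
        rw [h4]
        ring
      rw [e, pow_succ]
      push_cast
      linarith
  have hbound : ∑ j ∈ Finset.range (2 ^ jumpExponent (l + 1)), ∑ u ∈ U,
      (x (2 ^ jumpExponent (l + 1) * m + j) (coordFunction u)) ^ 2
      ≤ 2 ^ jumpExponent (l + 1) * (N * K ^ 2) := by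
    have h1 (j : ℕ) : ∑ u ∈ U, (x (2 ^ jumpExponent (l + 1) * m + j) (coordFunction u)) ^ 2
        ≤ N * K ^ 2 := by
      calc _ ≤ ∑ u ∈ U, K ^ 2 := by
            refine Finset.sum_le_sum fun u _ => ?_
            rw [← sq_abs]
            gcongr
            exact ((x _).norm_coe_le_norm _).trans (hxK _ (hpos _ j))
        _ = U.card * K ^ 2 := by rw [Finset.sum_const, nsmul_eq_mul]
        _ ≤ _ := by gcongr
    refine (Finset.sum_le_sum fun j _ => h1 j).trans_eq ?_
    rw [Finset.sum_const, Finset.card_range, nsmul_eq_mul]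
    push_cast
    rfl
  have hfin := le_of_mul_le_mul_left ((hgrow _ le_rfl).trans hbound) (by positivity)
  have hexp : (jumpExponent (l + 1) : ℝ) = (l + 1) * N ^ 2 := by
    rw [jumpExponent_succ, ← hk, hN]
    push_cast
    rw [← pow_mul, mul_comm (k + 1) 2, pow_mul]
    norm_num
  rw [hexp, show ((l : ℝ) + 1) * N ^ 2 * (δ ^ 2 / (16 * N)) = N * ((l + 1) * δ ^ 2 / 16) by
    field_simp] at hfin
  have h1 := le_of_mul_le_mul_left hfin hN0
  rw [div_lt_iff₀ (by positivity)] at hl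
  linarith

/-! ### Failure of the Radon-Nikodym property -/

theorem log_two_pow_mul_add {v j : ℕ} (hv : 1 ≤ v) (h : ℕ) (hj : j < 2 ^ h) :
    Nat.log 2 (2 ^ h * v + j) = Nat.log 2 v + h := by
  have h1 : 2 ^ Nat.log 2 v ≤ v := Nat.pow_log_le_self 2 (by omega)
  have h2 : v + 1 ≤ 2 ^ (Nat.log 2 v + 1) := Nat.lt_pow_succ_log_self (by norm_num) v
  refine Nat.log_eq_of_pow_le_of_lt_pow ?_ ?_
  · rw [pow_add, mul_comm]
    exact (Nat.mul_le_mul_left _ h1).trans (Nat.le_add_right _ _)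
  · calc 2 ^ h * v + j < 2 ^ h * v + 2 ^ h := by omega
      _ = 2 ^ h * (v + 1) := by ring
      _ ≤ 2 ^ h * 2 ^ (Nat.log 2 v + 1) := Nat.mul_le_mul_left _ h2
      _ = 2 ^ (Nat.log 2 v + h + 1) := by ring

theorem descendantIndicator_two_pow_mul_add {u v j h : ℕ} (hv : 1 ≤ v)
    (huv : Nat.log 2 u = Nat.log 2 v) (hj : j < 2 ^ h) :
    descendantIndicator u (2 ^ h * v + j) = if v = u then 1 else 0 := by
  rw [descendantIndicator, ancestor, log_two_pow_mul_add hv h hj, huv, Nat.add_sub_cancel_left,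
    Nat.mul_add_div (Nat.two_pow_pos h), Nat.div_eq_of_lt hj, add_zero]

/-- The mean of the evaluations at the descendants of `i` which are `h` levels below `i`. -/
noncomputable def descendantMean (h i : ℕ) : treeFunctions →ᵇ ℝ :=
  (2 ^ h : ℝ)⁻¹ • ∑ j ∈ Finset.range (2 ^ h), nodeEval (2 ^ h * i + j)

theorem descendantMean_mem (h i : ℕ) : descendantMean h i ∈ treeSpace :=
  treeSpace.smul_mem _ (treeSpace.sum_mem fun _ _ => nodeEval_mem _)

theorem descendantMean_apply (h i : ℕ) (G : treeFunctions) : descendantMean h i G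
    = (2 ^ h : ℝ)⁻¹ * ∑ j ∈ Finset.range (2 ^ h), G.1 (2 ^ h * i + j) := by
  simp [descendantMean, BoundedContinuousFunction.coe_sum, nodeEval_apply]

theorem norm_descendantMean_le (h i : ℕ) : ‖descendantMean h i‖ ≤ 1 := by
  rw [descendantMean, norm_smul, norm_inv, norm_pow, Real.norm_ofNat]
  have : ‖∑ j ∈ Finset.range (2 ^ h), nodeEval (2 ^ h * i + j)‖ ≤ 2 ^ h := by
    refine (norm_sum_le_of_le (n := fun _ => 1) _ fun j _ => norm_nodeEval_le _).trans_eq ?_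
    simp
  calc _ ≤ ((2 : ℝ) ^ h)⁻¹ * 2 ^ h := by gcongr
    _ = 1 := inv_mul_cancel₀ (by positivity)

theorem descendantMean_succ (h i : ℕ) : descendantMean (h + 1) i
    = (1 / 2 : ℝ) • (descendantMean h (2 * i) + descendantMean h (2 * i + 1)) := by
  simp only [descendantMean]
  rw [← smul_add, smul_smul, show 2 ^ (h + 1) = 2 ^ h + 2 ^ h by ring, Finset.sum_range_add]
  congr 1
  · rw [pow_succ, mul_inv]
    ring
  · congr 1 <;> refine Finset.sum_congr rfl fun j _ => ?_ <;> congr 1 <;> ring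

/-- The jumps of a tree function at a jump level are small in the mean, since the exponent
controlling them is small compared with the level. -/
theorem abs_sum_jump_le (G : treeFunctions) {i h l : ℕ} (hi : 1 ≤ i)
    (hl : jumpLevel l = Nat.log 2 i + h) :
    (2 ^ h : ℝ)⁻¹ * ∑ j ∈ Finset.range (2 ^ h),
        |G.1 (2 ^ h * i + j) - G.1 ((2 ^ h * i + j) / 2)|
      ≤ 2 ^ Nat.log 2 i * (1 / 2) ^ l := by
  set e := jumpExponent l with he
  have he0 : e ≠ 0 := (jumpExponent_pos l).ne'
  refine le_of_pow_le_pow_left₀ he0 (by positivity) ?_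
  have h1 := Real.pow_arith_mean_le_arith_mean_pow (Finset.range (2 ^ h)) (fun _ => (2 ^ h : ℝ)⁻¹)
    (fun j => |G.1 (2 ^ h * i + j) - G.1 ((2 ^ h * i + j) / 2)|) (fun _ _ => by positivity)
    (by simp) (fun _ _ => abs_nonneg _) e
  rw [← Finset.mul_sum, ← Finset.mul_sum] at h1
  have h2 : ∑ j ∈ Finset.range (2 ^ h), |G.1 (2 ^ h * i + j) - G.1 ((2 ^ h * i + j) / 2)| ^ e ≤ 1 := by
    refine le_trans ?_ (G.2.2.2.2 l)
    rw [← Finset.sum_image (s := Finset.range (2 ^ h)) (g := fun j => 2 ^ h * i + j)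
      (f := fun v => |G.1 v - G.1 (v / 2)| ^ e) (fun a _ b _ hab => Nat.add_left_cancel hab)]
    refine Finset.sum_le_sum_of_subset_of_nonneg ?_ fun _ _ _ => by positivity
    intro v hv
    obtain ⟨j, hj, rfl⟩ := Finset.mem_image.1 hv
    have hlog := log_two_pow_mul_add hi h (Finset.mem_range.1 hj)
    rw [← hl] at hlog
    rw [Finset.mem_Ico, ← hlog]
    refine ⟨Nat.pow_log_le_self 2 ?_, Nat.lt_pow_succ_log_self (by norm_num) _⟩
    have := Nat.mul_pos (Nat.two_pow_pos h) hi
    omega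
  calc _ ≤ (2 ^ h : ℝ)⁻¹ * 1 := h1.trans (by gcongr)
    _ = 2 ^ Nat.log 2 i * (1 / 2) ^ jumpLevel l := by
      rw [hl, pow_add, one_div, inv_pow, inv_pow]
      field_simp
    _ ≤ (2 ^ Nat.log 2 i) ^ e * (1 / 2) ^ (l * e) := by
      refine mul_le_mul ?_ ?_ (by positivity) (by positivity)
      · exact le_self_pow₀ (one_le_pow₀ (by norm_num)) he0
      · exact pow_le_pow_of_le_one (by norm_num) (by norm_num) (mul_jumpExponent_le_jumpLevel l)
    _ = (2 ^ Nat.log 2 i * (1 / 2) ^ l) ^ e := by rw [mul_pow, pow_mul]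

/-- The bound for the change of the means `descendantMean h i`: it is nonzero only if the level
reached is a jump level. -/
noncomputable def jumpBound : ℕ → ℝ := Function.extend jumpLevel (fun l => (1 / 2 : ℝ) ^ l) 0

theorem summable_jumpBound : Summable jumpBound :=
  (summable_extend_zero strictMono_jumpLevel.injective).2 summable_geometric_two

theorem norm_descendantMean_succ_sub_le {i : ℕ} (hi : 1 ≤ i) (h : ℕ) :
    ‖descendantMean (h + 1) i - descendantMean h i‖
      ≤ 2 ^ Nat.log 2 i * jumpBound (Nat.log 2 i + (h + 1)) := by
  have hbound0 : 0 ≤ jumpBound (Nat.log 2 i + (h + 1)) := by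
    by_cases hl : ∃ l, jumpLevel l = Nat.log 2 i + (h + 1)
    · obtain ⟨l, hl⟩ := hl
      rw [← hl, jumpBound, strictMono_jumpLevel.injective.extend_apply]
      positivity
    · rw [jumpBound, Function.extend_apply' _ _ _ hl, Pi.zero_apply]
  refine (BoundedContinuousFunction.norm_le (by positivity)).2 fun G => ?_
  have hG : (descendantMean (h + 1) i - descendantMean h i) G
      = (2 ^ (h + 1) : ℝ)⁻¹ * ∑ j ∈ Finset.range (2 ^ (h + 1)),
        (G.1 (2 ^ (h + 1) * i + j) - G.1 ((2 ^ (h + 1) * i + j) / 2)) := by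
    have e : ∑ j ∈ Finset.range (2 ^ (h + 1)), G.1 ((2 ^ (h + 1) * i + j) / 2)
        = 2 * ∑ j ∈ Finset.range (2 ^ h), G.1 (2 ^ h * i + j) := by
      rw [pow_succ' 2 h, Finset.sum_range_two_mul, Finset.mul_sum]
      refine Finset.sum_congr rfl fun j _ => ?_
      rw [show (2 * 2 ^ h * i + 2 * j) / 2 = 2 ^ h * i + j by rw [mul_assoc]; omega,
        show (2 * 2 ^ h * i + (2 * j + 1)) / 2 = 2 ^ h * i + j by rw [mul_assoc]; omega]
      ring
    rw [BoundedContinuousFunction.coe_sub, Pi.sub_apply, descendantMean_apply,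
      descendantMean_apply, Finset.sum_sub_distrib, e, pow_succ]
    field_simp
  rw [hG, norm_mul, Real.norm_of_nonneg (by positivity)]
  by_cases hl : ∃ l, jumpLevel l = Nat.log 2 i + (h + 1)
  · obtain ⟨l, hl⟩ := hl
    refine le_trans ?_ ((abs_sum_jump_le G hi hl).trans_eq ?_)
    · gcongr
      exact norm_sum_le _ _
    · rw [← hl, jumpBound, strictMono_jumpLevel.injective.extend_apply]
  · rw [Finset.sum_eq_zero, norm_zero, mul_zero]
    · positivity
    · intro j hj
      rw [sub_eq_zero]
      refine G.2.2.2.1 _ ?_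
      rw [log_two_pow_mul_add hi _ (Finset.mem_range.1 hj)]
      exact hl

/-- The limits of the means `descendantMean h i` form a bounded dyadic martingale in `treeSpace`
whose increments at the jump levels do not tend to `0`. -/
theorem not_hasRadonNikodymProperty_treeSpace : ¬ HasRadonNikodymProperty treeSpace := by
  intro hX
  have hlim (i : ℕ) : ∃ y : treeSpace,
      1 ≤ i → Tendsto (fun h => descendantMean h i) atTop (𝓝 y.1) := by
    obtain hi | hi := Nat.lt_or_ge i 1
    · exact ⟨0, fun h => by omega⟩
    · have hs : Summable fun h => 2 ^ Nat.log 2 i * jumpBound (Nat.log 2 i + (h + 1)) :=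
        (summable_jumpBound.comp_injective
          (i := fun h => Nat.log 2 i + (h + 1)) fun a b hab => by simpa using hab).mul_left _
      obtain ⟨y, hy⟩ := cauchySeq_tendsto_of_complete (cauchySeq_of_dist_le_of_summable
        (f := fun h => descendantMean h i) _ (fun h => by
          rw [dist_comm, dist_eq_norm]
          exact norm_descendantMean_succ_sub_le hi h) hs)
      have hmem : y ∈ treeSpace := (Submodule.isClosed_topologicalClosure _).mem_of_tendsto hy
        (Eventually.of_forall fun h => descendantMean_mem h i)
      exact ⟨⟨y, hmem⟩, fun _ => hy⟩
  choose x hx using hlim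
  have hmart (i : ℕ) (hi : 1 ≤ i) : x i = (1 / 2 : ℝ) • (x (2 * i) + x (2 * i + 1)) := by
    refine Subtype.ext (tendsto_nhds_unique ((hx i hi).comp (tendsto_add_atTop_nat 1)) ?_)
    refine (((hx (2 * i) (by omega)).add (hx (2 * i + 1) (by omega))).const_smul (1 / 2 : ℝ)).congr
      fun h => ?_
    exact (descendantMean_succ h i).symm
  have hbdd (i : ℕ) (hi : 1 ≤ i) : ‖x i‖ ≤ 1 :=
    le_of_tendsto (hx i hi).norm (Eventually.of_forall fun h => norm_descendantMean_le h i)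
  obtain ⟨k₀, hk₀⟩ := hX.exists_increment_lt (by norm_num : (0 : ℝ) < 1 / 2) hmart hbdd
  have hlev : k₀ + 1 ≤ jumpLevel (k₀ + 1) := strictMono_jumpLevel.le_apply
  obtain ⟨i, hi, hlt⟩ := hk₀ (jumpLevel (k₀ + 1) - 1) (by omega)
  set n := 2 ^ (jumpLevel (k₀ + 1) - 1) + i with hn
  have hn1 : 1 ≤ n := le_add_right Nat.one_le_two_pow
  have hlogn : Nat.log 2 n = jumpLevel (k₀ + 1) - 1 := by
    refine Nat.log_eq_of_pow_le_of_lt_pow (Nat.le_add_right _ _) ?_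
    rw [pow_succ]
    omega
  have hlog : Nat.log 2 (2 * n) = jumpLevel (k₀ + 1) := by
    have := log_two_pow_mul_add hn1 1 (by norm_num : 0 < 2 ^ 1)
    rw [pow_one, add_zero] at this
    omega
  have hlog' : Nat.log 2 (2 * n + 1) = jumpLevel (k₀ + 1) := by
    have := log_two_pow_mul_add hn1 1 (by norm_num : 1 < 2 ^ 1)
    rw [pow_one] at this
    omega
  -- the coordinate at the node `2 * n` separates the two children of `n`
  have hval {v : ℕ} (hv : 1 ≤ v) (hlogv : Nat.log 2 v = jumpLevel (k₀ + 1)) :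
      (x v).1 (coordFunction (2 * n)) = if v = 2 * n then 1 else 0 := by
    have hcont : Continuous fun y : treeFunctions →ᵇ ℝ => y (coordFunction (2 * n)) :=
      (BoundedContinuousFunction.evalCLM ℝ (coordFunction (2 * n))).continuous
    refine tendsto_nhds_unique ((hcont.tendsto _).comp (hx v hv)) ?_
    refine tendsto_const_nhds.congr fun h => ?_
    rw [Function.comp_apply, descendantMean_apply, Finset.sum_congr rfl fun j hj => by
      rw [coordFunction_apply (by omega) (hlog ▸ mem_range_self _),
        descendantIndicator_two_pow_mul_add hv (hlog.trans hlogv.symm) (Finset.mem_range.1 hj)]]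
    simp
  have h1 : (x (2 * n) - x n).1 (coordFunction (2 * n)) = 1 / 2 := by
    have h3 := hval (v := 2 * n) (by omega) hlog
    have h4 := hval (v := 2 * n + 1) (by omega) hlog'
    rw [if_pos rfl] at h3
    rw [if_neg (by omega)] at h4
    rw [hmart n hn1]
    simp [h3, h4]
    norm_num
  have h2 : |(x (2 * n) - x n).1 (coordFunction (2 * n))| ≤ ‖x (2 * n) - x n‖ :=
    (x (2 * n) - x n).1.norm_coe_le_norm _
  rw [h1, abs_of_pos (by norm_num)] at h2
  linarith

theorem mainTheorem4 :
    (∀ (X : Type*) [NormedAddCommGroup X] [NormedSpace ℝ X] [CompleteSpace X],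
      BilipschitzEmbeddable DiamondOmega X → ¬ HasRadonNikodymProperty X) ∧
    (∃ (X : Type) (_ : NormedAddCommGroup X) (_ : NormedSpace ℝ X) (_ : CompleteSpace X),
      ¬ HasRadonNikodymProperty X ∧
      (∀ δ : ℝ, 0 < δ → ¬ ContainsBoundedDeltaTree X δ) ∧
      ¬ BilipschitzEmbeddable DiamondOmega X) := by
  refine ⟨fun X _ _ _ h hX => ?_, treeSpace, inferInstance, inferInstance, inferInstance,
    not_hasRadonNikodymProperty_treeSpace, fun δ hδ => not_containsBoundedDeltaTree_treeSpace hδ,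
    fun h => ?_⟩
  · obtain ⟨δ, hδ, hδX⟩ := h.exists_containsBoundedDeltaTree
    exact hX.not_containsBoundedDeltaTree hδ hδX
  · obtain ⟨δ, hδ, hδX⟩ := h.exists_containsBoundedDeltaTree
    exact not_containsBoundedDeltaTree_treeSpace hδ hδX
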